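/- Let $(\mathfrak H,(\cdot,\cdot))$ be a complex Hilbert space, let $J$ be a bounded operator on $\mathfrak H$ with $J=J^*$, $J^2=I$, put $[f,g]=(Jf,g)$ and $\mathfrak H_\pm=\frac12(I\pm J)\mathfrak H$. A subspace $\mathfrak L$ is called positive (negative) if $[f,f]>0$ ($[f,f]<0$) for all nonzero $f\in\mathfrak L$; it is called maximal positive (negative) if it is closed, positive (negative) and not a proper subspace of a positive (negative) subspace. For a maximal positive subspace $\mathfrak L_+$ let $\mathfrak L_-=\{f:[f,g]=0\ \forall g\in\mathfrak L_+\}$, let $\mathcal D=\mathfrak L_+[\dot+]\mathfrak L_-$ be the resulting $J$-orthogonal direct sum, and let $\mathcal C$ be the operator of this direct sum: $D(\mathcal C)=\mathcal D$, $\mathcal C(f_++f_-)=f_+-f_-$ for $f_\pm\in\mathfrak L_\pm$. A transition operator of the direct sum is a bounded self-adjoint operator $T$ with $\|Tf\|<\|f\|$ for all $f\ne0$, $JT=-TJ$ and $\mathfrak L_\pm=(I+T)\mathfrak H_\pm$. Then: (a) Every operator $\mathcal C$ of such a direct sum is densely defined, and its adjoint $\mathcal C^*$ is again the operator of such a direct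 sum. (b) For every such direct sum $\mathfrak L_+[\dot+]\mathfrak L_-$ with operator $\mathcal C$, the subspace $J\mathfrak L_+$ is maximal positive, its $J$-orthogonal complement is $J\mathfrak L_-$, which is maximal negative, and $\mathcal C^*$ is the operator of the dual direct sum $J\mathfrak L_+[\dot+]J\mathfrak L_-$. The direct sum $\mathfrak L_+[\dot+]\mathfrak L_-$ has exactly one transition operator, and a bounded operator $T$ is its transition operator if and only if $-T$ is the transition operator of the dual direct sum. (c) If $\mathcal C=Je^{Q}$, where $Q$ is a (possibly unbounded) self-adjoint operator in $\mathfrak H$ with $JQ=-QJ$, then $\mathcal C^*=Je^{-Q}$, where $-Q$ is again self-adjoint and anticommutes with $J$. Moreover, $\mathcal C$ is the operator of some direct sum $\mathfrak L_+[\dot+]\mathfrak L_-$ as above, and $\mathcal C^*$ is the operator of the dual direct sum $J\mathfrak L_+[\dot+]J\mathfrak L_-$. -/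

import Mathlib

open scoped InnerProductSpace LinearPMap

noncomputable section

namespace Krein

variable {H : Type*} [NormedAddCommGroup H] [InnerProductSpace ℂ H]

/-- A fundamental symmetry: a bounded self-adjoint operator `J` with `J² = I`. -/
structure IsFundamentalSymmetry [CompleteSpace H] (J : H →L[ℂ] H) : Prop where
  isSelfAdjoint : IsSelfAdjoint J
  sq_eq_one : J * J = 1

/-- The indefinite inner product `[f, g] = (J f, g)`, where `(f, g)` is linear in `f`
(Mathlib's `⟪g, f⟫_ℂ`). -/
def indefInner (J : H →L[ℂ] H) (f g : H) : ℂ := ⟪g, J f⟫_ℂ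

/-- `[f, f] > 0` for all nonzero `f` in the subspace (the numbers `[f, f]` are real). -/
def IsPositive (J : H →L[ℂ] H) (L : Submodule ℂ H) : Prop :=
  ∀ f ∈ L, f ≠ 0 → 0 < (indefInner J f f).re

/-- `[f, f] < 0` for all nonzero `f` in the subspace. -/
def IsNegative (J : H →L[ℂ] H) (L : Submodule ℂ H) : Prop :=
  ∀ f ∈ L, f ≠ 0 → (indefInner J f f).re < 0

/-- A closed positive subspace that is not a proper subspace of a positive subspace. -/
structure IsMaximalPositive (J : H →L[ℂ] H) (L : Submodule ℂ H) : Prop where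
  isClosed : IsClosed (L : Set H)
  isPositive : IsPositive J L
  maximal : ∀ M : Submodule ℂ H, IsPositive J M → L ≤ M → M = L

/-- A closed negative subspace that is not a proper subspace of a negative subspace. -/
structure IsMaximalNegative (J : H →L[ℂ] H) (L : Submodule ℂ H) : Prop where
  isClosed : IsClosed (L : Set H)
  isNegative : IsNegative J L
  maximal : ∀ M : Submodule ℂ H, IsNegative J M → L ≤ M → M = L

/-- The `J`-orthogonal complement `{f | [f, g] = 0 for all g ∈ L}`. -/
def indefOrthogonal (J : H →L[ℂ] H) (L : Submodule ℂ H) : Submodule ℂ H where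
  carrier := {f | ∀ g ∈ L, indefInner J f g = 0}
  add_mem' := by
    intro a b ha hb g hg
    have h1 := ha g hg
    have h2 := hb g hg
    simp only [indefInner, map_add, inner_add_right] at *
    rw [h1, h2, add_zero]
  zero_mem' := by
    intro g _
    simp [indefInner]
  smul_mem' := by
    intro c a ha g hg
    have h1 := ha g hg
    simp only [indefInner, map_smul, inner_smul_right] at *
    rw [h1, mul_zero]

/-- The pair `L₊`, `L₋` of a `J`-orthogonal direct sum: `L₊` is maximal positive and
`L₋` is its `J`-orthogonal complement. -/
structure IsDirectSumPair (J : H →L[ℂ] H) (Lp Lm : Submodule ℂ H) : Prop where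
  maximalPositive : IsMaximalPositive J Lp
  eq_orthogonal : Lm = indefOrthogonal J Lp

/-- The operator with domain `L₊ + L₋` and `f₊ + f₋ ↦ f₊ - f₋`, given by its graph
`{(f₊ + f₋, f₊ - f₋)}` (which is single-valued when `L₊ ∩ L₋ = {0}`). -/
def directSumOperator (Lp Lm : Submodule ℂ H) : H →ₗ.[ℂ] H :=
  ((Lp.prod Lm).map
    ((LinearMap.fst ℂ H H + LinearMap.snd ℂ H H).prod
      (LinearMap.fst ℂ H H - LinearMap.snd ℂ H H))).toLinearPMap

/-- The image `J L` of a subspace. -/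
def image (J : H →L[ℂ] H) (L : Submodule ℂ H) : Submodule ℂ H :=
  L.map (J : H →ₗ[ℂ] H)

/-- `H₊ = ½ (I + J) H`. -/
def fundPlus (J : H →L[ℂ] H) : Submodule ℂ H :=
  image ((2 : ℂ)⁻¹ • (1 + J)) ⊤

/-- `H₋ = ½ (I - J) H`. -/
def fundMinus (J : H →L[ℂ] H) : Submodule ℂ H :=
  image ((2 : ℂ)⁻¹ • (1 - J)) ⊤

/-- `T` is an operator of transition from the fundamental decomposition `H₊ [⊕] H₋` to the pair
`L₊`, `L₋`: a self-adjoint strong contraction that anticommutes with `J` and satisfies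
`L₊ = (I + T) H₊`, `L₋ = (I + T) H₋`. -/
structure IsTransitionOperator [CompleteSpace H] (J T : H →L[ℂ] H) (Lp Lm : Submodule ℂ H) :
    Prop where
  isSelfAdjoint : IsSelfAdjoint T
  strong_contraction : ∀ f : H, f ≠ 0 → ‖T f‖ < ‖f‖
  anticommute : J * T = -(T * J)
  plus_eq : Lp = image (1 + T) (fundPlus J)
  minus_eq : Lm = image (1 + T) (fundMinus J)

/-- `J Q = -Q J` for a partially defined operator `Q`, domains included. -/
structure Anticommutes (J : H →L[ℂ] H) (Q : H →ₗ.[ℂ] H) : Prop where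
  mem_domain_iff : ∀ x : H, J x ∈ Q.domain ↔ x ∈ Q.domain
  apply_eq : ∀ (x : Q.domain) (hx : J x ∈ Q.domain), J (Q x) = -Q ⟨J x, hx⟩

/-- A projection-valued measure (resolution of the identity) on the Borel sets of `ℝ`.
Only the values at Borel sets matter. -/
structure SpectralMeasure (H : Type*) [NormedAddCommGroup H] [InnerProductSpace ℂ H]
    [CompleteSpace H] where
  proj : Set ℝ → H →L[ℂ] H
  isSelfAdjoint : ∀ S, MeasurableSet S → IsSelfAdjoint (proj S)
  proj_univ : proj Set.univ = 1
  proj_inter : ∀ S T, MeasurableSet S → MeasurableSet T → proj (S ∩ T) = proj S * proj T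
  hasSum : ∀ S : ℕ → Set ℝ, (∀ i, MeasurableSet (S i)) →
    Pairwise (Function.onFun Disjoint S) →
    ∀ x : H, HasSum (fun i => proj (S i) x) (proj (⋃ i, S i) x)

namespace SpectralMeasure

variable [CompleteSpace H]

theorem re_inner_nonneg (E : SpectralMeasure H) (x : H) {S : Set ℝ} (hS : MeasurableSet S) :
    0 ≤ (⟪x, E.proj S x⟫_ℂ).re := by
  have h1 : E.proj S = E.proj S * E.proj S := by
    rw [← E.proj_inter S S hS hS, Set.inter_self]
  have h2 : ⟪x, E.proj S x⟫_ℂ = ⟪E.proj S x, E.proj S x⟫_ℂ := by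
    conv_lhs => rw [h1]
    have h3 := E.isSelfAdjoint S hS
    rw [ContinuousLinearMap.isSelfAdjoint_iff_isSymmetric] at h3
    exact (h3 x (E.proj S x)).symm
  rw [h2]
  exact inner_self_nonneg (𝕜 := ℂ) (x := E.proj S x)

theorem proj_empty (E : SpectralMeasure H) (x : H) : E.proj ∅ x = 0 := by
  have h := E.hasSum (fun _ => ∅) (fun _ => MeasurableSet.empty)
    (fun _ _ _ => disjoint_bot_left) x
  exact tendsto_nhds_unique tendsto_const_nhds h.summable.tendsto_atTop_zero

/-- The scalar measure `μ_x(S) = (E(S) x, x)`. -/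
def scalar (E : SpectralMeasure H) (x : H) : MeasureTheory.Measure ℝ :=
  MeasureTheory.Measure.ofMeasurable (fun S _ => ENNReal.ofReal (⟪x, E.proj S x⟫_ℂ).re)
    (by simp [E.proj_empty x])
    (by
      intro S hS hd
      have h1 := (E.hasSum S hS hd x).mapL (innerSL ℂ x)
      have h2 := Complex.hasSum_re h1
      simp only [innerSL_apply_apply] at h2
      rw [← h2.tsum_eq]
      exact ENNReal.ofReal_tsum_of_nonneg (fun i => E.re_inner_nonneg x (hS i)) h2.summable)

/-- `A = ∫ f dE` for a real Borel function `f`: the domain of `A` is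
`{x | ∫ |f|² dμ_x < ∞}` and `(A x, x) = ∫ f dμ_x` on it (by polarization this determines `A`). -/
structure IsIntegral (E : SpectralMeasure H) (f : ℝ → ℝ) (A : H →ₗ.[ℂ] H) : Prop where
  mem_domain_iff : ∀ x : H, x ∈ A.domain ↔ ∫⁻ t, ENNReal.ofReal (f t ^ 2) ∂(E.scalar x) < ⊤
  inner_eq : ∀ x : A.domain, ⟪(x : H), A x⟫_ℂ = ((∫ t, f t ∂(E.scalar (x : H)) : ℝ) : ℂ)

end SpectralMeasure

/-- `A = e^Q` in the functional calculus of the self-adjoint operator `Q`: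
`Q = ∫ t dE(t)` and `A = ∫ e^t dE(t)`, where `E` is the spectral measure of `Q`. -/
def IsExp [CompleteSpace H] (Q A : H →ₗ.[ℂ] H) : Prop :=
  ∃ E : SpectralMeasure H, E.IsIntegral (fun t => t) Q ∧ E.IsIntegral Real.exp A

/-- `C = J e^Q` with a self-adjoint operator `Q` such that `J Q = -Q J`. -/
structure IsExpForm [CompleteSpace H] (J : H →L[ℂ] H) (Q C : H →ₗ.[ℂ] H) : Prop where
  isSelfAdjoint : IsSelfAdjoint Q
  anticommutes : Anticommutes J Q
  eq_comp : ∃ A : H →ₗ.[ℂ] H, IsExp Q A ∧ C = (J : H →ₗ[ℂ] H).compPMap A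

/-- `C` is the operator of some `J`-orthogonal direct sum. -/
def IsCOperator (J : H →L[ℂ] H) (C : H →ₗ.[ℂ] H) : Prop :=
  ∃ Lp Lm : Submodule ℂ H, IsDirectSumPair J Lp Lm ∧ C = directSumOperator Lp Lm

end Krein

end

/-! Everything is symmetric under `J ↦ -J`, which exchanges `H₊` with `H₋` and `L₊` with `L₋`.

If `L₊` is maximal positive, then `H = L₊ ⊕ H₋`. With `P` the projection onto `L₊` along `H₋`, the
operator `T = P + P⋆ - (1 + J)` is the transition operator, and the graph of `C` becomes
`{(f, g) | T (f + J g) = f - J g}`. The adjoint of `C` is found by pairing its graph with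
`L₊ᗮ = J L₋` and `L₋ᗮ = J L₊`.

If `C = J e^Q` with spectral measure `E`, the Cayley transform `T = (1 - e^Q) (1 + e^Q)⁻¹` is a
self-adjoint strict contraction with the same relation to the graph of `C`. The function
`(1 - e^t) / (1 + e^t)` is odd, so `T` anticommutes with `J` once `J` is known to map `E` to its
reflection. This holds because the spectral measure of `Q` is unique: it is determined on the
resolvent function `(t - i)⁻¹`, hence, by Stone–Weierstrass, on all bounded continuous functions. -/

noncomputable section

namespace Krein

variable {H : Type*} [NormedAddCommGroup H] [InnerProductSpace ℂ H]
  {J T : H →L[ℂ] H} {L Lp Lm : Submodule ℂ H}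

theorem mem_image {K : H →L[ℂ] H} {x : H} : x ∈ image K L ↔ ∃ y ∈ L, K y = x :=
  Iff.rfl

theorem mem_indefOrthogonal {x : H} : x ∈ indefOrthogonal J L ↔ ∀ y ∈ L, ⟪y, J x⟫_ℂ = 0 :=
  Iff.rfl

theorem fundMinus_eq_fundPlus_neg (J : H →L[ℂ] H) : fundMinus J = fundPlus (-J) := by
  rw [fundMinus, fundPlus, sub_eq_add_neg]

theorem fundMinus_neg (J : H →L[ℂ] H) : fundMinus (-J) = fundPlus J := by
  rw [fundMinus_eq_fundPlus_neg, neg_neg]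

theorem IsMaximalPositive.isMaximalNegative (h : IsMaximalPositive (-J) L) :
    IsMaximalNegative J L := by
  have isPositive_neg_iff (M : Submodule ℂ H) : IsPositive (-J) M ↔ IsNegative J M := by
    simp [IsPositive, IsNegative, indefInner]
  exact ⟨h.isClosed, (isPositive_neg_iff L).1 h.isPositive,
    fun M hM => h.maximal M ((isPositive_neg_iff M).2 hM)⟩

theorem mem_graph_directSumOperator (h : Disjoint Lp Lm) {x y : H} :
    (x, y) ∈ (directSumOperator Lp Lm).graph ↔ x + y ∈ Lp ∧ x - y ∈ Lm := by
  rw [directSumOperator, Submodule.toLinearPMap_graph_eq]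
  · constructor
    · rintro ⟨⟨l, m⟩, ⟨hl, hm⟩, hlm⟩
      obtain ⟨rfl, rfl⟩ : l + m = x ∧ l - m = y := Prod.ext_iff.1 hlm
      have hl' : l + m + (l - m) = (2 : ℂ) • l := by module
      have hm' : l + m - (l - m) = (2 : ℂ) • m := by module
      exact ⟨hl' ▸ Lp.smul_mem 2 hl, hm' ▸ Lm.smul_mem 2 hm⟩
    · rintro ⟨hp, hm⟩
      refine ⟨((2 : ℂ)⁻¹ • (x + y), (2 : ℂ)⁻¹ • (x - y)),
        ⟨Lp.smul_mem _ hp, Lm.smul_mem _ hm⟩, Prod.ext ?_ ?_⟩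
      · change (2 : ℂ)⁻¹ • (x + y) + (2 : ℂ)⁻¹ • (x - y) = x
        module
      · change (2 : ℂ)⁻¹ • (x + y) - (2 : ℂ)⁻¹ • (x - y) = y
        module
  · rintro _ ⟨⟨l, m⟩, ⟨hl, hm⟩, rfl⟩ hx
    have hlm : l = -m := eq_neg_of_add_eq_zero_left hx
    have hl0 : l = 0 := Submodule.disjoint_def.1 h l hl (hlm ▸ Lm.neg_mem hm)
    have hm0 : m = 0 := by rwa [hl0, eq_comm, neg_eq_zero] at hlm
    simp [hl0, hm0]

theorem domain_directSumOperator (h : Disjoint Lp Lm) :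
    (directSumOperator Lp Lm).domain = Lp ⊔ Lm := by
  refine le_antisymm (fun x hx => ?_) (sup_le (fun x hx => ?_) fun x hx => ?_)
  · obtain ⟨y, hxy⟩ := LinearPMap.mem_domain_iff.1 hx
    obtain ⟨hp, hm⟩ := (mem_graph_directSumOperator h).1 hxy
    have hsum : (2 : ℂ)⁻¹ • (x + y) + (2 : ℂ)⁻¹ • (x - y) = x := by module
    exact Submodule.mem_sup.2 ⟨_, Lp.smul_mem _ hp, _, Lm.smul_mem _ hm, hsum⟩
  · refine LinearPMap.mem_domain_of_mem_graph (y := x) ((mem_graph_directSumOperator h).2 ?_)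
    exact ⟨Lp.add_mem hx hx, by simp⟩
  · refine LinearPMap.mem_domain_of_mem_graph (y := -x) ((mem_graph_directSumOperator h).2 ?_)
    exact ⟨by simp, by simpa using Lm.add_mem hx hx⟩

theorem IsPositive.disjoint_indefOrthogonal (hL : IsPositive J L) :
    Disjoint L (indefOrthogonal J L) := by
  refine Submodule.disjoint_def.2 fun x hx hx' => by_contra fun h0 => ?_
  have h := hL x hx h0
  rw [hx' x hx] at h
  exact lt_irrefl _ h

theorem IsPositive.norm_le_norm_add_apply (hL : IsPositive J L) {x : H} (hx : x ∈ L) :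
    ‖x‖ ≤ ‖x + J x‖ := by
  have hnonneg : 0 ≤ (⟪x, J x⟫_ℂ).re := by
    rcases eq_or_ne x 0 with rfl | h0
    · simp
    · exact (hL x hx h0).le
  have hsq := _root_.norm_add_sq (𝕜 := ℂ) x (J x)
  rw [RCLike.re_eq_complex_re] at hsq
  exact le_of_sq_le_sq (by linarith [sq_nonneg ‖J x‖]) (norm_nonneg _)

theorem IsDirectSumPair.disjoint (h : IsDirectSumPair J Lp Lm) : Disjoint Lp Lm :=
  h.eq_orthogonal ▸ h.maximalPositive.isPositive.disjoint_indefOrthogonal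

theorem apply_apply_of_anticommute (hJT : J * T = -(T * J)) (x : H) : J (T x) = -T (J x) :=
  congr($hJT x)

theorem fundPlus_eq_range (J : H →L[ℂ] H) :
    fundPlus J = LinearMap.range (1 + J : H →L[ℂ] H).toLinearMap := by
  rw [fundPlus, image, Submodule.map_top]
  exact LinearMap.range_smul _ _ (inv_ne_zero two_ne_zero)

theorem image_range (K B : H →L[ℂ] H) :
    image K (LinearMap.range B.toLinearMap) = LinearMap.range (K * B).toLinearMap :=
  (LinearMap.range_comp _ _).symm

theorem Anticommutes.neg {Q : H →ₗ.[ℂ] H} (h : Anticommutes J Q) : Anticommutes J (-Q) where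
  mem_domain_iff := h.mem_domain_iff
  apply_eq x hx := by
    rw [LinearPMap.neg_apply, LinearPMap.neg_apply, map_neg]
    exact congrArg Neg.neg (h.apply_eq x hx)

theorem mem_graph_neg_iff {Q : H →ₗ.[ℂ] H} {x y : H} :
    (x, y) ∈ (-Q).graph ↔ (x, -y) ∈ Q.graph := by
  simp only [LinearPMap.mem_graph_iff, LinearPMap.neg_apply, neg_eq_iff_eq_neg]
  rfl

theorem eq_of_forall_inner_apply_self {A B : H →L[ℂ] H} (h : ∀ x, ⟪x, A x⟫_ℂ = ⟪x, B x⟫_ℂ) :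
    A = B := by
  refine ContinuousLinearMap.coe_inj.1 ((ext_inner_map (A : H →ₗ[ℂ] H) B).1 fun x => ?_)
  simpa only [inner_conj_symm] using! congrArg (starRingEnd ℂ) (h x)

variable [CompleteSpace H]

namespace IsFundamentalSymmetry

theorem neg (hJ : IsFundamentalSymmetry J) : IsFundamentalSymmetry (-J) :=
  ⟨hJ.isSelfAdjoint.neg, by rw [neg_mul_neg, hJ.sq_eq_one]⟩

theorem apply_apply (hJ : IsFundamentalSymmetry J) (x : H) : J (J x) = x :=
  congr($hJ.sq_eq_one x)

theorem inner_left (hJ : IsFundamentalSymmetry J) (x y : H) : ⟪J x, y⟫_ℂ = ⟪x, J y⟫_ℂ :=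
  hJ.isSelfAdjoint.isSymmetric x y

theorem mem_image_iff (hJ : IsFundamentalSymmetry J) {x : H} : x ∈ image J L ↔ J x ∈ L :=
  ⟨fun ⟨y, hy, hyx⟩ => by rwa [← hyx, ContinuousLinearMap.coe_coe, hJ.apply_apply],
    fun hx => ⟨J x, hx, hJ.apply_apply x⟩⟩

theorem image_image (hJ : IsFundamentalSymmetry J) (L : Submodule ℂ H) :
    image J (image J L) = L := by
  ext x
  rw [hJ.mem_image_iff, hJ.mem_image_iff, hJ.apply_apply]

theorem mem_fundPlus (hJ : IsFundamentalSymmetry J) {x : H} : x ∈ fundPlus J ↔ J x = x := by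
  constructor
  · rintro ⟨y, -, rfl⟩
    simp [hJ.apply_apply, add_comm]
  · intro hx
    refine ⟨x, trivial, ?_⟩
    change (2 : ℂ)⁻¹ • (x + J x) = x
    rw [hx]
    module

theorem mem_fundMinus (hJ : IsFundamentalSymmetry J) {x : H} : x ∈ fundMinus J ↔ J x = -x := by
  rw [fundMinus_eq_fundPlus_neg, hJ.neg.mem_fundPlus, neg_apply, neg_eq_iff_eq_neg]

theorem add_apply_mem_fundPlus (hJ : IsFundamentalSymmetry J) (x : H) : x + J x ∈ fundPlus J := by
  rw [hJ.mem_fundPlus, map_add, hJ.apply_apply, add_comm]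

theorem exists_add_eq (hJ : IsFundamentalSymmetry J) (x : H) :
    ∃ a b, J a = a ∧ J b = -b ∧ a + b = x :=
  ⟨(2 : ℂ)⁻¹ • (x + J x), (2 : ℂ)⁻¹ • (x - J x),
    by simp only [map_smul, map_add, hJ.apply_apply, add_comm],
    by simp only [map_smul, map_sub, hJ.apply_apply, ← smul_neg, neg_sub], by module⟩

theorem inner_eq_zero (hJ : IsFundamentalSymmetry J) {a b : H} (ha : J a = a) (hb : J b = -b) :
    ⟪a, b⟫_ℂ = 0 := by
  have h := hJ.inner_left a b
  rwa [ha, hb, inner_neg_right, self_eq_neg] at h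

theorem norm_add_sq (hJ : IsFundamentalSymmetry J) {a b : H} (ha : J a = a) (hb : J b = -b) :
    ‖a + b‖ ^ 2 = ‖a‖ ^ 2 + ‖b‖ ^ 2 := by
  simpa [sq] using norm_add_sq_eq_norm_sq_add_norm_sq_of_inner_eq_zero a b (hJ.inner_eq_zero ha hb)

theorem re_indefInner_add (hJ : IsFundamentalSymmetry J) {a b : H} (ha : J a = a)
    (hb : J b = -b) : (indefInner J (a + b) (a + b)).re = ‖a‖ ^ 2 - ‖b‖ ^ 2 := by
  have hba : ⟪b, a⟫_ℂ = 0 := inner_eq_zero_symm.1 (hJ.inner_eq_zero ha hb)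
  rw [indefInner, map_add, ha, hb]
  simp [inner_add_left, hJ.inner_eq_zero ha hb, hba,
    inner_self_eq_norm_sq_to_K, ← Complex.ofReal_pow, sub_eq_add_neg]

theorem ker_one_add (hJ : IsFundamentalSymmetry J) :
    LinearMap.ker (1 + J : H →L[ℂ] H).toLinearMap = fundMinus J := by
  ext x
  rw [hJ.mem_fundMinus, eq_neg_iff_add_eq_zero, add_comm]
  exact Iff.rfl

theorem isClosed_fundMinus (hJ : IsFundamentalSymmetry J) :
    IsClosed (fundMinus J : Set H) := by
  rw [← hJ.ker_one_add]
  exact (1 + J).isClosed_ker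

theorem mem_fundPlus_of_mem_orthogonal_fundMinus (hJ : IsFundamentalSymmetry J) {x : H}
    (hx : x ∈ (fundMinus J)ᗮ) : x ∈ fundPlus J := by
  obtain ⟨a, b, ha, hb, rfl⟩ := hJ.exists_add_eq x
  have hb0 : ⟪b, b⟫_ℂ = 0 := by
    have h := Submodule.mem_orthogonal _ _ |>.1 hx b (hJ.mem_fundMinus.2 hb)
    rwa [inner_add_right, inner_eq_zero_symm.1 (hJ.inner_eq_zero ha hb), zero_add] at h
  rwa [inner_self_eq_zero.1 hb0, add_zero, hJ.mem_fundPlus]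

theorem indefOrthogonal_eq_image (hJ : IsFundamentalSymmetry J) (L : Submodule ℂ H) :
    indefOrthogonal J L = image J Lᗮ := by
  ext x
  rw [hJ.mem_image_iff, mem_indefOrthogonal, Submodule.mem_orthogonal]

theorem orthogonal_image (hJ : IsFundamentalSymmetry J) (L : Submodule ℂ H) :
    (image J L)ᗮ = image J Lᗮ := by
  ext x
  rw [hJ.mem_image_iff, Submodule.mem_orthogonal, Submodule.mem_orthogonal]
  constructor
  · intro h y hy
    rw [← hJ.inner_left]
    exact h _ ⟨y, hy, rfl⟩
  · rintro h _ ⟨y, hy, rfl⟩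
    exact (hJ.inner_left y x).trans (h y hy)

theorem orthogonal_indefOrthogonal (hJ : IsFundamentalSymmetry J) (hL : IsClosed (L : Set H)) :
    (indefOrthogonal J L)ᗮ = image J L := by
  have : CompleteSpace L := hL.completeSpace_coe
  rw [hJ.indefOrthogonal_eq_image, hJ.orthogonal_image, L.orthogonal_orthogonal]

end IsFundamentalSymmetry

namespace IsPositive

theorem disjoint_fundMinus (hL : IsPositive J L) (hJ : IsFundamentalSymmetry J) :
    Disjoint L (fundMinus J) := by
  refine Submodule.disjoint_def.2 fun x hx hx' => by_contra fun h0 => ?_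
  have hpos := hL x hx h0
  have hneg := hJ.re_indefInner_add (map_zero J) (hJ.mem_fundMinus.1 hx')
  rw [zero_add, norm_zero] at hneg
  nlinarith [sq_nonneg ‖x‖]

theorem isMaximalPositive (hL : IsPositive J L) (hJ : IsFundamentalSymmetry J)
    (hcl : IsClosed (L : Set H)) (hcod : Codisjoint L (fundMinus J)) : IsMaximalPositive J L where
  isClosed := hcl
  isPositive := hL
  maximal _ hM hLM :=
    (eq_of_le_of_inf_le_of_le_sup hLM
      ((hM.disjoint_fundMinus hJ).le_bot.trans bot_le) (hcod.eq_top ▸ le_top)).symm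

theorem isClosed_sup_fundMinus (hL : IsPositive J L) (hJ : IsFundamentalSymmetry J)
    (hcl : IsClosed (L : Set H)) : IsClosed (↑(L ⊔ fundMinus J) : Set H) := by
  have : CompleteSpace L := hcl.completeSpace_coe
  have himage : IsClosed (image (1 + J) L : Set H) := by
    have hanti : AntilipschitzWith 1 ((1 + J) ∘L L.subtypeL) :=
      AddMonoidHomClass.antilipschitz_of_bound _ fun x => by
        simpa using hL.norm_le_norm_add_apply x.2
    have hrange := hanti.isClosed_range ((1 + J) ∘L L.subtypeL).uniformContinuous
    convert hrange using 1
    ext x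
    simp [mem_image]
  rw [← hJ.ker_one_add, ← Submodule.comap_map_eq]
  exact himage.preimage (1 + J).continuous

theorem sup_span_singleton (hL : IsPositive J L) (hJ : IsFundamentalSymmetry J) {a : H}
    (ha : J a = a) (haL : a ∈ Lᗮ) : IsPositive J (L ⊔ ℂ ∙ a) := by
  intro f hf hf0
  obtain ⟨l, hl, m, hm, rfl⟩ := Submodule.mem_sup.1 hf
  obtain ⟨c, rfl⟩ := Submodule.mem_span_singleton.1 hm
  have hJm : J (c • a) = c • a := by rw [map_smul, ha]
  have hlm : ⟪l, c • a⟫_ℂ = 0 := Lᗮ.smul_mem c haL l hl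
  have hml : ⟪c • a, J l⟫_ℂ = 0 := by rw [← hJ.inner_left, hJm, inner_eq_zero_symm.1 hlm]
  have hsplit : (indefInner J (l + c • a) (l + c • a)).re =
      (indefInner J l l).re + ‖c • a‖ ^ 2 := by
    rw [indefInner, indefInner, map_add, hJm, inner_add_right, inner_add_left, inner_add_left,
      hml, hlm, add_zero, zero_add, Complex.add_re, ← RCLike.re_eq_complex_re,
      inner_self_eq_norm_sq]
  rw [hsplit]
  rcases eq_or_ne l 0 with rfl | hl0
  · rw [zero_add] at hf0
    simpa [indefInner] using pow_pos (norm_pos_iff.2 hf0) 2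
  · exact add_pos_of_pos_of_nonneg (hL l hl hl0) (sq_nonneg _)

end IsPositive

theorem IsMaximalPositive.isCompl_fundMinus (hL : IsMaximalPositive J L)
    (hJ : IsFundamentalSymmetry J) : IsCompl L (fundMinus J) := by
  refine ⟨hL.isPositive.disjoint_fundMinus hJ, codisjoint_iff.2 ?_⟩
  rw [← (hL.isPositive.isClosed_sup_fundMinus hJ hL.isClosed).submodule_topologicalClosure_eq,
    Submodule.topologicalClosure_eq_top_iff, ← Submodule.inf_orthogonal, eq_bot_iff]
  rintro x ⟨hxL, hxM⟩
  have hx : J x = x := hJ.mem_fundPlus.1 (hJ.mem_fundPlus_of_mem_orthogonal_fundMinus hxM)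
  have hmax := hL.maximal _ (hL.isPositive.sup_span_singleton hJ hx hxL) le_sup_left
  have hx_mem : x ∈ L := hmax ▸ Submodule.mem_sup_right (Submodule.mem_span_singleton_self x)
  exact (Submodule.mem_bot ℂ).2 (inner_self_eq_zero.1 (hxL x hx_mem))

namespace IsFundamentalSymmetry

-- `T = P + P⋆ - (1 + J)`, where `P` is the projection onto `L` along `H₋`. Comparing kernels and
-- ranges, `P J = P` and `(1 + J) P = 1 + J`, and these relations give `(1 + T) (1 + J) = 2 P`.
theorem exists_image_one_add_fundPlus_eq (hJ : IsFundamentalSymmetry J)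
    (hL : IsClosed (L : Set H)) (hc : IsCompl L (fundMinus J)) :
    ∃ T : H →L[ℂ] H, IsSelfAdjoint T ∧ J * T = -(T * J) ∧ image (1 + T) (fundPlus J) = L := by
  have htop := Submodule.IsCompl.isTopCompl_of_isClosed hc hL hJ.isClosed_fundMinus
  set P := L.projectionL (fundMinus J) htop
  have hPJ : P * J = P := by
    ext x
    have hx : J x - x ∈ fundMinus J := by rw [hJ.mem_fundMinus, map_sub, hJ.apply_apply, neg_sub]
    change P (J x) = P x
    rw [← sub_eq_zero, ← map_sub, Submodule.projectionL_apply_eq_zero_iff htop]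
    exact hx
  have hJP : (1 + J) * P = 1 + J := by
    ext x
    change P x + J (P x) = x + J x
    have hx : x - P x ∈ fundMinus J := by
      rw [← Submodule.projectionL_eq_self_sub_projectionL htop]
      exact Submodule.projectionL_apply_mem htop.symm x
    rw [hJ.mem_fundMinus, map_sub, neg_sub, sub_eq_sub_iff_add_eq_add] at hx
    exact hx.symm.trans (add_comm _ _)
  have hPJ' : J * star P = star P := by simpa [hJ.isSelfAdjoint.star_eq] using congr(star $hPJ)
  have hJP' : star P * (1 + J) = 1 + J := by
    simpa [hJ.isSelfAdjoint.star_eq] using congr(star $hJP)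
  have hP : (1 + (P + star P - (1 + J))) * (1 + J) = (2 : ℂ) • P := by
    have hJJ : J * (1 + J) = 1 + J := by rw [mul_add, mul_one, hJ.sq_eq_one, add_comm]
    have hPP : P * (1 + J) = P + P := by rw [mul_add, mul_one, hPJ]
    have hsum : 1 + (P + star P - (1 + J)) = P + star P - J := by abel
    rw [hsum, sub_mul, add_mul, hPP, hJP', hJJ, add_sub_cancel_right, two_smul]
  refine ⟨P + star P - (1 + J), ?_, ?_, ?_⟩
  · simp [isSelfAdjoint_iff, hJ.isSelfAdjoint.star_eq, add_comm]
  · have hJP₁ : J * P = 1 + J - P := by rw [← hJP, add_mul, one_mul, add_sub_cancel_left]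
    have hJP₂ : star P * J = 1 + J - star P := by
      rw [← hJP', mul_add, mul_one, add_sub_cancel_left]
    rw [mul_sub, mul_add, mul_add, mul_one, hPJ', hJP₁, hJ.sq_eq_one, sub_mul, add_mul, add_mul,
      one_mul, hPJ, hJP₂, hJ.sq_eq_one]
    abel
  · rw [fundPlus_eq_range, image_range, hP, ← Submodule.range_projectionL htop]
    exact LinearMap.range_smul _ _ two_ne_zero

theorem norm_apply_lt_of_isPositive (hJ : IsFundamentalSymmetry J) (hJT : J * T = -(T * J))
    (hpos : IsPositive J (image (1 + T) (fundPlus J))) {x : H} (hx : J x = x) (hx0 : x ≠ 0) :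
    ‖T x‖ < ‖x‖ := by
  have hTx : J (T x) = -T x := by rw [apply_apply_of_anticommute hJT, hx]
  have hmem : x + T x ∈ image (1 + T) (fundPlus J) := ⟨x, hJ.mem_fundPlus.2 hx, rfl⟩
  have hne : x + T x ≠ 0 := by
    intro h0
    have hsq := hJ.norm_add_sq hx hTx
    rw [h0, norm_zero] at hsq
    exact hx0 (norm_eq_zero.1 (by nlinarith [sq_nonneg ‖x‖, sq_nonneg ‖T x‖]))
  have h := hpos _ hmem hne
  rw [hJ.re_indefInner_add hx hTx, sub_pos] at h
  exact lt_of_pow_lt_pow_left₀ 2 (norm_nonneg x) h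

theorem norm_apply_lt_of_fundPlus (hJ : IsFundamentalSymmetry J) (hT : IsSelfAdjoint T)
    (hJT : J * T = -(T * J)) (hplus : ∀ x, J x = x → x ≠ 0 → ‖T x‖ < ‖x‖) {x : H} (hx : x ≠ 0) :
    ‖T x‖ < ‖x‖ := by
  have hplus_le (a : H) (ha : J a = a) : ‖T a‖ ≤ ‖a‖ := by
    rcases eq_or_ne a 0 with rfl | ha0
    · simp
    · exact (hplus a ha ha0).le
  have hminus (b : H) (hb : J b = -b) (hb0 : b ≠ 0) : ‖T b‖ < ‖b‖ := by
    have hTb : J (T b) = T b := by rw [apply_apply_of_anticommute hJT, hb, map_neg, neg_neg]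
    rcases eq_or_ne (T b) 0 with h0 | h0
    · rwa [h0, norm_zero, norm_pos_iff]
    · refine lt_of_mul_lt_mul_left ?_ (norm_nonneg (T b))
      calc ‖T b‖ * ‖T b‖ = ‖⟪T (T b), b⟫_ℂ‖ := by
            have hsymm : ⟪T (T b), b⟫_ℂ = ⟪T b, T b⟫_ℂ := hT.isSymmetric (T b) b
            rw [hsymm, inner_self_eq_norm_sq_to_K]
            simp [sq]
        _ ≤ ‖T (T b)‖ * ‖b‖ := norm_inner_le_norm _ _
        _ < ‖T b‖ * ‖b‖ := by
            gcongr
            exact hplus _ hTb h0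
  obtain ⟨a, b, ha, hb, rfl⟩ := hJ.exists_add_eq x
  have hTa : J (T a) = -T a := by rw [apply_apply_of_anticommute hJT, ha]
  have hTb : J (T b) = T b := by rw [apply_apply_of_anticommute hJT, hb, map_neg, neg_neg]
  refine lt_of_pow_lt_pow_left₀ 2 (norm_nonneg _) ?_
  rw [map_add, add_comm (T a), hJ.norm_add_sq hTb hTa, hJ.norm_add_sq ha hb, add_comm]
  rcases eq_or_ne b 0 with rfl | hb0
  · rw [add_zero] at hx
    simpa using pow_lt_pow_left₀ (hplus a ha hx) (norm_nonneg _) two_ne_zero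
  · exact add_lt_add_of_le_of_lt (pow_le_pow_left₀ (norm_nonneg _) (hplus_le a ha) 2)
      (pow_lt_pow_left₀ (hminus b hb hb0) (norm_nonneg _) two_ne_zero)

theorem mem_image_one_add_fundPlus (hJ : IsFundamentalSymmetry J) (hJT : J * T = -(T * J))
    {x : H} : x ∈ image (1 + T) (fundPlus J) ↔ T (x + J x) = x - J x := by
  constructor
  · rintro ⟨a, ha, rfl⟩
    have ha' := hJ.mem_fundPlus.1 ha
    have hTa : J (T a) = -T a := by rw [apply_apply_of_anticommute hJT, ha']
    change T (a + T a + J (a + T a)) = a + T a - J (a + T a)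
    have hsum : a + T a + J (a + T a) = a + a := by rw [map_add, ha', hTa]; abel
    rw [hsum, map_add, map_add, ha', hTa]
    abel
  · intro h
    refine ⟨(2 : ℂ)⁻¹ • (x + J x),
      (fundPlus J).smul_mem _ (hJ.add_apply_mem_fundPlus x), ?_⟩
    change (2 : ℂ)⁻¹ • (x + J x) + T ((2 : ℂ)⁻¹ • (x + J x)) = x
    rw [map_smul, h]
    module

theorem mem_image_one_add_fundMinus (hJ : IsFundamentalSymmetry J) (hJT : J * T = -(T * J))
    {x : H} : x ∈ image (1 + T) (fundMinus J) ↔ T (x - J x) = x + J x := by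
  have hJT' : -J * T = -(T * -J) := by rw [neg_mul, hJT, mul_neg]
  rw [fundMinus_eq_fundPlus_neg, hJ.neg.mem_image_one_add_fundPlus hJT', neg_apply,
    ← sub_eq_add_neg, sub_neg_eq_add]

theorem indefOrthogonal_image_one_add_fundPlus (hJ : IsFundamentalSymmetry J)
    (hT : IsSelfAdjoint T) (hJT : J * T = -(T * J)) :
    indefOrthogonal J (image (1 + T) (fundPlus J)) = image (1 + T) (fundMinus J) := by
  ext x
  have hadj : ContinuousLinearMap.adjoint ((1 + T) * (1 + J)) = (1 + J) * (1 + T) := by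
    rw [← ContinuousLinearMap.star_eq_adjoint, star_mul, star_add, star_add, star_one,
      hJ.isSelfAdjoint.star_eq, hT.star_eq]
  have hker : ((1 + J) * (1 + T)) (J x) = x + J x - T (x - J x) := by
    have hJTJ : J (T (J x)) = -T x := by rw [apply_apply_of_anticommute hJT, hJ.apply_apply]
    change J x + T (J x) + J (J x + T (J x)) = _
    rw [map_add, hJ.apply_apply, hJTJ, map_sub]
    abel
  rw [hJ.indefOrthogonal_eq_image, hJ.mem_image_iff, fundPlus_eq_range, image_range,
    ContinuousLinearMap.orthogonal_range, hadj, hJ.mem_image_one_add_fundMinus hJT,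
    LinearMap.mem_ker, ContinuousLinearMap.coe_coe, hker, sub_eq_zero, eq_comm]

end IsFundamentalSymmetry

namespace IsTransitionOperator

variable {S : H →L[ℂ] H}

theorem swap (hT : IsTransitionOperator J T Lp Lm) : IsTransitionOperator (-J) T Lm Lp where
  isSelfAdjoint := hT.isSelfAdjoint
  strong_contraction := hT.strong_contraction
  anticommute := by rw [neg_mul, hT.anticommute, mul_neg]
  plus_eq := by rw [← fundMinus_eq_fundPlus_neg, hT.minus_eq]
  minus_eq := by rw [fundMinus_neg, hT.plus_eq]

theorem mem_plus (hT : IsTransitionOperator J T Lp Lm) (hJ : IsFundamentalSymmetry J) {x : H} :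
    x ∈ Lp ↔ T (x + J x) = x - J x := by
  rw [hT.plus_eq, hJ.mem_image_one_add_fundPlus hT.anticommute]

theorem mem_minus (hT : IsTransitionOperator J T Lp Lm) (hJ : IsFundamentalSymmetry J) {x : H} :
    x ∈ Lm ↔ T (x - J x) = x + J x := by
  rw [hT.minus_eq, hJ.mem_image_one_add_fundMinus hT.anticommute]

theorem isPositive (hT : IsTransitionOperator J T Lp Lm) (hJ : IsFundamentalSymmetry J) :
    IsPositive J Lp := by
  intro f hf hf0
  obtain ⟨x, hx, rfl⟩ := hT.plus_eq ▸ hf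
  have hx' := hJ.mem_fundPlus.1 hx
  have hTx : J (T x) = -T x := by rw [apply_apply_of_anticommute hT.anticommute, hx']
  have hx0 : x ≠ 0 := by
    rintro rfl
    simp at hf0
  change 0 < (indefInner J (x + T x) (x + T x)).re
  rw [hJ.re_indefInner_add hx' hTx, sub_pos]
  exact pow_lt_pow_left₀ (hT.strong_contraction x hx0) (norm_nonneg _) two_ne_zero

theorem isMaximalPositive (hT : IsTransitionOperator J T Lp Lm) (hJ : IsFundamentalSymmetry J) :
    IsMaximalPositive J Lp := by
  refine (hT.isPositive hJ).isMaximalPositive hJ ?_ ?_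
  · simp_rw [← SetLike.setOfPred_mem_eq, hT.mem_plus hJ]
    exact isClosed_eq (by fun_prop) (by fun_prop)
  · rw [codisjoint_iff, eq_top_iff]
    rintro x -
    obtain ⟨a, b, ha, hb, rfl⟩ := hJ.exists_add_eq x
    have hTa : J (T a) = -T a := by rw [apply_apply_of_anticommute hT.anticommute, ha]
    refine Submodule.mem_sup.2 ⟨a + T a, ?_, b - T a, ?_, by abel⟩
    · rw [hT.plus_eq]
      exact ⟨a, hJ.mem_fundPlus.2 ha, rfl⟩
    · rw [hJ.mem_fundMinus, map_sub, hb, hTa]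
      abel

theorem isDirectSumPair (hT : IsTransitionOperator J T Lp Lm) (hJ : IsFundamentalSymmetry J) :
    IsDirectSumPair J Lp Lm where
  maximalPositive := hT.isMaximalPositive hJ
  eq_orthogonal := by
    rw [hT.minus_eq, hT.plus_eq,
      hJ.indefOrthogonal_image_one_add_fundPlus hT.isSelfAdjoint hT.anticommute]

theorem isMaximalNegative (hT : IsTransitionOperator J T Lp Lm) (hJ : IsFundamentalSymmetry J) :
    IsMaximalNegative J Lm :=
  (hT.swap.isMaximalPositive hJ.neg).isMaximalNegative

theorem neg_image (hT : IsTransitionOperator J T Lp Lm) (hJ : IsFundamentalSymmetry J) :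
    IsTransitionOperator J (-T) (image J Lp) (image J Lm) := by
  have hJT : J * -T = -(-T * J) := by rw [mul_neg, hT.anticommute, neg_mul]
  refine ⟨hT.isSelfAdjoint.neg, by simpa using hT.strong_contraction, hJT, ?_, ?_⟩
  · ext x
    rw [hJ.mem_image_iff, hT.mem_plus hJ, hJ.mem_image_one_add_fundPlus hJT, hJ.apply_apply,
      neg_apply, neg_eq_iff_eq_neg, neg_sub, add_comm]
  · ext x
    rw [hJ.mem_image_iff, hT.mem_minus hJ, hJ.mem_image_one_add_fundMinus hJT, hJ.apply_apply,
      ← neg_sub x, map_neg, neg_apply, add_comm]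

theorem neg_image_iff (hJ : IsFundamentalSymmetry J) :
    IsTransitionOperator J (-T) (image J Lp) (image J Lm) ↔ IsTransitionOperator J T Lp Lm :=
  ⟨fun hT => by simpa [hJ.image_image] using hT.neg_image hJ, fun hT => hT.neg_image hJ⟩

theorem apply_eq_of_mem_fundPlus (hT : IsTransitionOperator J T Lp Lm)
    (hS : IsTransitionOperator J S Lp Lm) (hJ : IsFundamentalSymmetry J) {x : H} (hx : J x = x) :
    S x = T x := by
  have hTx : J (T x) = -T x := by rw [apply_apply_of_anticommute hT.anticommute, hx]
  have hmem : x + T x ∈ Lp := by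
    rw [hT.plus_eq]
    exact ⟨x, hJ.mem_fundPlus.2 hx, rfl⟩
  have hsum : x + T x + J (x + T x) = (2 : ℂ) • x := by rw [map_add, hx, hTx]; module
  have hdiff : x + T x - J (x + T x) = (2 : ℂ) • T x := by rw [map_add, hx, hTx]; module
  have h := (hS.mem_plus hJ).1 hmem
  rw [hsum, hdiff, map_smul] at h
  exact smul_right_injective H two_ne_zero h

theorem unique (hT : IsTransitionOperator J T Lp Lm) (hS : IsTransitionOperator J S Lp Lm)
    (hJ : IsFundamentalSymmetry J) : S = T := by
  ext x
  obtain ⟨a, b, ha, hb, rfl⟩ := hJ.exists_add_eq x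
  have hb' : (-J) b = b := by rw [neg_apply, hb, neg_neg]
  rw [map_add, map_add, hT.apply_eq_of_mem_fundPlus hS hJ ha,
    hT.swap.apply_eq_of_mem_fundPlus hS.swap hJ.neg hb']

theorem mem_graph_directSumOperator (hT : IsTransitionOperator J T Lp Lm)
    (hJ : IsFundamentalSymmetry J) {x y : H} :
    (x, y) ∈ (directSumOperator Lp Lm).graph ↔ T (x + J y) = x - J y := by
  rw [Krein.mem_graph_directSumOperator (hT.isDirectSumPair hJ).disjoint, hT.mem_plus hJ,
    hT.mem_minus hJ]
  have hJT (z : H) : J (T z) = -T (J z) := apply_apply_of_anticommute hT.anticommute z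
  constructor
  · rintro ⟨hp, hm⟩
    have hsum : (2 : ℂ) • (x + J y) = x + y + J (x + y) + (x - y - J (x - y)) := by
      rw [map_add, map_sub]; module
    refine smul_right_injective H (two_ne_zero (α := ℂ)) ?_
    change (2 : ℂ) • T (x + J y) = (2 : ℂ) • (x - J y)
    rw [← map_smul, hsum, map_add, hp, hm, map_add, map_sub]
    module
  · intro h
    have h' : T (y + J x) = y - J x := by
      have h2 := congr(J $h)
      rw [hJT, map_add, map_sub, hJ.apply_apply, neg_eq_iff_eq_neg, neg_sub, add_comm] at h2
      exact h2
    constructor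
    · rw [show x + y + J (x + y) = x + J y + (y + J x) by rw [map_add]; abel, map_add, h, h',
        map_add]
      abel
    · rw [show x - y - J (x - y) = x + J y - (y + J x) by rw [map_sub]; abel, map_sub, h, h',
        map_sub]
      abel

end IsTransitionOperator

namespace IsDirectSumPair

theorem exists_isTransitionOperator (h : IsDirectSumPair J Lp Lm) (hJ : IsFundamentalSymmetry J) :
    ∃ T, IsTransitionOperator J T Lp Lm := by
  obtain ⟨T, hT, hJT, hLp⟩ := hJ.exists_image_one_add_fundPlus_eq h.maximalPositive.isClosed
    (h.maximalPositive.isCompl_fundMinus hJ)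
  have hplus (x : H) (hx : J x = x) (hx0 : x ≠ 0) : ‖T x‖ < ‖x‖ :=
    hJ.norm_apply_lt_of_isPositive hJT (hLp ▸ h.maximalPositive.isPositive) hx hx0
  refine ⟨T, hT, fun x => hJ.norm_apply_lt_of_fundPlus hT hJT hplus, hJT, hLp.symm, ?_⟩
  rw [h.eq_orthogonal, ← hLp, hJ.indefOrthogonal_image_one_add_fundPlus hT hJT]

theorem orthogonal_plus (h : IsDirectSumPair J Lp Lm) (hJ : IsFundamentalSymmetry J) :
    Lpᗮ = image J Lm := by
  rw [h.eq_orthogonal, hJ.indefOrthogonal_eq_image, hJ.image_image]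

theorem orthogonal_minus (h : IsDirectSumPair J Lp Lm) (hJ : IsFundamentalSymmetry J) :
    Lmᗮ = image J Lp := by
  rw [h.eq_orthogonal, hJ.orthogonal_indefOrthogonal h.maximalPositive.isClosed]

theorem disjoint_image (h : IsDirectSumPair J Lp Lm) (hJ : IsFundamentalSymmetry J) :
    Disjoint (image J Lp) (image J Lm) := by
  simp_rw [Submodule.disjoint_def, hJ.mem_image_iff]
  intro x hp hm
  rw [← hJ.apply_apply x, Submodule.disjoint_def.1 h.disjoint _ hp hm, map_zero]

theorem dense_domain_directSumOperator (h : IsDirectSumPair J Lp Lm)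
    (hJ : IsFundamentalSymmetry J) : Dense ((directSumOperator Lp Lm).domain : Set H) := by
  rw [domain_directSumOperator h.disjoint,
    Submodule.dense_iff_topologicalClosure_eq_top, Submodule.topologicalClosure_eq_top_iff,
    ← Submodule.inf_orthogonal, h.orthogonal_plus hJ, h.orthogonal_minus hJ]
  exact (h.disjoint_image hJ).symm.eq_bot

theorem adjoint_directSumOperator (h : IsDirectSumPair J Lp Lm) (hJ : IsFundamentalSymmetry J) :
    (directSumOperator Lp Lm)† = directSumOperator (image J Lp) (image J Lm) := by
  refine LinearPMap.eq_of_eq_graph ?_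
  rw [LinearPMap.adjoint_graph_eq_graph_adjoint (h.dense_domain_directSumOperator hJ)]
  ext ⟨y, z⟩
  rw [mem_graph_directSumOperator (h.disjoint_image hJ), ← h.orthogonal_minus hJ,
    ← h.orthogonal_plus hJ, Submodule.mem_adjoint_iff]
  constructor
  · intro hyz
    constructor
    · intro m hm
      have hmz := hyz m (-m) ((mem_graph_directSumOperator h.disjoint).2
        ⟨by rw [add_neg_cancel]; exact Lp.zero_mem, by simpa using Lm.add_mem hm hm⟩)
      rw [inner_neg_left] at hmz
      rw [inner_add_right]
      linear_combination -hmz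
    · intro l hl
      rw [inner_sub_right]
      exact hyz l l ((mem_graph_directSumOperator h.disjoint).2
        ⟨Lp.add_mem hl hl, by rw [sub_self]; exact Lm.zero_mem⟩)
  · rintro ⟨hm, hp⟩ a b hab
    obtain ⟨hplus, hminus⟩ := (mem_graph_directSumOperator h.disjoint).1 hab
    have h₁ := hp _ hplus
    have h₂ := hm _ hminus
    simp only [inner_add_left, inner_sub_left, inner_add_right, inner_sub_right] at h₁ h₂
    linear_combination (1 / 2 : ℂ) * h₁ - (1 / 2 : ℂ) * h₂

end IsDirectSumPair

theorem Anticommutes.mem_graph_neg_iff {Q : H →ₗ.[ℂ] H} (h : Anticommutes J Q)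
    (hJ : IsFundamentalSymmetry J) (x y : H) : (x, y) ∈ (-Q).graph ↔ (J x, J y) ∈ Q.graph := by
  have himp (x y : H) (hxy : (x, y) ∈ Q.graph) : (J x, -J y) ∈ Q.graph := by
    obtain ⟨z, rfl, rfl⟩ := Q.mem_graph_iff.1 hxy
    have hz := (h.mem_domain_iff z).2 z.2
    rw [h.apply_eq z hz, neg_neg]
    exact Q.mem_graph ⟨J z, hz⟩
  rw [Krein.mem_graph_neg_iff]
  refine ⟨fun hxy => ?_, fun hxy => ?_⟩
  · simpa only [map_neg, neg_neg] using himp _ _ hxy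
  · simpa only [hJ.apply_apply] using himp _ _ hxy

theorem isSelfAdjoint_neg {Q : H →ₗ.[ℂ] H} (hQ : IsSelfAdjoint Q) : IsSelfAdjoint (-Q) := by
  have hdense : Dense (Q.domain : Set H) := hQ.dense_domain
  have hgraph : Q.graph.adjoint = Q.graph := by
    rw [← LinearPMap.adjoint_graph_eq_graph_adjoint hdense, LinearPMap.isSelfAdjoint_def.1 hQ]
  rw [LinearPMap.isSelfAdjoint_def]
  apply LinearPMap.eq_of_eq_graph
  rw [LinearPMap.adjoint_graph_eq_graph_adjoint (T := -Q) hdense]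
  ext ⟨x, y⟩
  rw [mem_graph_neg_iff, ← hgraph, Submodule.mem_adjoint_iff, Submodule.mem_adjoint_iff]
  refine ⟨fun h a b hab => ?_, fun h a b hab => ?_⟩
  · have := h a (-b) (mem_graph_neg_iff.2 (by rwa [neg_neg]))
    rw [inner_neg_left] at this
    rw [inner_neg_right]
    linear_combination -this
  · have := h a (-b) (mem_graph_neg_iff.1 hab)
    rw [inner_neg_left, inner_neg_right] at this
    linear_combination -this

section Spectral

open MeasureTheory Filter
open scoped Topology BoundedContinuousFunction NNReal

namespace SpectralMeasure

variable {E F : SpectralMeasure H} {φ : ℝ → ℝ}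

section HasIntegral

variable {A B : H →L[ℂ] H} {f g : ℝ → ℂ}

theorem scalar_apply (E : SpectralMeasure H) (x : H) {S : Set ℝ} (hS : MeasurableSet S) :
    E.scalar x S = ENNReal.ofReal (⟪x, E.proj S x⟫_ℂ).re :=
  Measure.ofMeasurable_apply S hS

instance (E : SpectralMeasure H) (x : H) : IsFiniteMeasure (E.scalar x) :=
  ⟨by rw [E.scalar_apply x MeasurableSet.univ]; exact ENNReal.ofReal_lt_top⟩

theorem inner_proj_self (E : SpectralMeasure H) (x : H) {S : Set ℝ} (hS : MeasurableSet S) :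
    ⟪x, E.proj S x⟫_ℂ = ((E.scalar x).real S : ℂ) := by
  rw [Measure.real, E.scalar_apply x hS, ENNReal.toReal_ofReal (E.re_inner_nonneg x hS)]
  have hsymm := ContinuousLinearMap.isSelfAdjoint_iff_isSymmetric.1 (E.isSelfAdjoint S hS)
  exact (hsymm.coe_re_inner_self_apply x).symm

theorem real_scalar_univ (E : SpectralMeasure H) (x : H) :
    (E.scalar x).real Set.univ = ‖x‖ ^ 2 := by
  have h := E.inner_proj_self x MeasurableSet.univ
  rw [E.proj_univ, one_apply_eq_self, inner_self_eq_norm_sq_to_K] at h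
  exact Complex.ofReal_injective (by simpa using h.symm)

/-- `B = ∫ f dE` for a bounded operator `B`, given by the quadratic form of `B`. -/
def HasIntegral (E : SpectralMeasure H) (f : ℝ → ℂ) (B : H →L[ℂ] H) : Prop :=
  ∀ x : H, ⟪x, B x⟫_ℂ = ∫ t, f t ∂E.scalar x

namespace HasIntegral

theorem unique (hA : E.HasIntegral f A) (hB : E.HasIntegral f B) : A = B :=
  eq_of_forall_inner_apply_self fun x => (hA x).trans (hB x).symm

theorem add (hA : E.HasIntegral f A) (hB : E.HasIntegral g B)
    (hf : ∀ x, Integrable f (E.scalar x)) (hg : ∀ x, Integrable g (E.scalar x)) :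
    E.HasIntegral (f + g) (A + B) := fun x => by
  rw [add_apply, inner_add_right, hA x, hB x, ← integral_add (hf x) (hg x)]
  rfl

theorem sub (hA : E.HasIntegral f A) (hB : E.HasIntegral g B)
    (hf : ∀ x, Integrable f (E.scalar x)) (hg : ∀ x, Integrable g (E.scalar x)) :
    E.HasIntegral (f - g) (A - B) := fun x => by
  rw [sub_apply, inner_sub_right, hA x, hB x, ← integral_sub (hf x) (hg x)]
  rfl

protected theorem star (hA : E.HasIntegral f A) : E.HasIntegral (star f) (star A) := fun x => by
  rw [ContinuousLinearMap.star_eq_adjoint, ContinuousLinearMap.adjoint_inner_right,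
    ← inner_conj_symm, hA x, ← integral_conj]
  rfl

theorem norm_apply_sq (hA : E.HasIntegral (star f * f) (star A * A)) (x : H) :
    ‖A x‖ ^ 2 = ∫ t, ‖f t‖ ^ 2 ∂E.scalar x := by
  have h : ⟪A x, A x⟫_ℂ = ∫ t, (star f * f) t ∂E.scalar x := by
    rw [← hA x, mul_apply_eq_comp, ContinuousLinearMap.star_eq_adjoint,
      ContinuousLinearMap.adjoint_inner_right]
  simp only [Pi.mul_apply, Pi.star_apply, RCLike.star_def, RCLike.conj_mul,
    inner_self_eq_norm_sq_to_K] at h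
  simp only [← Complex.ofReal_pow, Complex.coe_algebraMap, integral_complex_ofReal] at h
  exact_mod_cast h

theorem piecewise_const {S : Set ℝ} (hS : MeasurableSet S) (c : ℂ) :
    E.HasIntegral (SimpleFunc.piecewise S hS (.const ℝ c) (.const ℝ 0)) (c • E.proj S) := by
  intro x
  have hind : (SimpleFunc.piecewise S hS (.const ℝ c) (.const ℝ 0) : ℝ → ℂ) =
      S.indicator fun _ => c := by
    ext t
    by_cases ht : t ∈ S <;> simp [ht]
  rw [hind, integral_indicator_const _ hS, smul_apply, inner_smul_right,
    E.inner_proj_self x hS, Complex.real_smul, mul_comm]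

theorem add_simpleFunc {s r : SimpleFunc ℝ ℂ} (hA : E.HasIntegral s A)
    (hB : E.HasIntegral r B) : E.HasIntegral (s + r : SimpleFunc ℝ ℂ) (A + B) :=
  hA.add hB (fun _ => s.integrable_of_isFiniteMeasure) fun _ => r.integrable_of_isFiniteMeasure

theorem exists_simpleFunc (E : SpectralMeasure H) (s : SimpleFunc ℝ ℂ) :
    ∃ A, E.HasIntegral s A := by
  induction s using SimpleFunc.induction with
  | @const c S hS => exact ⟨_, piecewise_const hS c⟩
  | @add s r _ hs hr =>
    obtain ⟨A, hA⟩ := hs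
    obtain ⟨B, hB⟩ := hr
    exact ⟨A + B, hA.add_simpleFunc hB⟩

theorem piecewise_const_mul_piecewise_const {S S' : Set ℝ} (hS : MeasurableSet S)
    (hS' : MeasurableSet S') (c d : ℂ) :
    E.HasIntegral (SimpleFunc.piecewise S hS (.const ℝ c) (.const ℝ 0) *
      SimpleFunc.piecewise S' hS' (.const ℝ d) (.const ℝ 0) : SimpleFunc ℝ ℂ)
      (c • E.proj S * d • E.proj S') := by
  rw [smul_mul_smul_comm, ← E.proj_inter S S' hS hS']
  convert piecewise_const (hS.inter hS') (c * d) using 2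
  ext t
  by_cases h : t ∈ S <;> by_cases h' : t ∈ S' <;> simp [h, h']

theorem piecewise_const_mul {S : Set ℝ} (hS : MeasurableSet S) (c : ℂ) {r : SimpleFunc ℝ ℂ}
    (hB : E.HasIntegral r B) :
    E.HasIntegral (SimpleFunc.piecewise S hS (.const ℝ c) (.const ℝ 0) * r : SimpleFunc ℝ ℂ)
      (c • E.proj S * B) := by
  induction r using SimpleFunc.induction generalizing B with
  | @const d S' hS' =>
    rw [hB.unique (piecewise_const hS' d)]
    exact piecewise_const_mul_piecewise_const hS hS' c d
  | @add r r' _ hr hr' =>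
    obtain ⟨B₁, hB₁⟩ := exists_simpleFunc E r
    obtain ⟨B₂, hB₂⟩ := exists_simpleFunc E r'
    rw [hB.unique (hB₁.add_simpleFunc hB₂), mul_add, mul_add]
    exact (hr hB₁).add_simpleFunc (hr' hB₂)

theorem mul_simpleFunc {s r : SimpleFunc ℝ ℂ} (hA : E.HasIntegral s A)
    (hB : E.HasIntegral r B) : E.HasIntegral (s * r : SimpleFunc ℝ ℂ) (A * B) := by
  induction s using SimpleFunc.induction generalizing A with
  | @const c S hS =>
    rw [hA.unique (piecewise_const hS c)]
    exact piecewise_const_mul hS c hB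
  | @add s s' _ hs hs' =>
    obtain ⟨A₁, hA₁⟩ := exists_simpleFunc E s
    obtain ⟨A₂, hA₂⟩ := exists_simpleFunc E s'
    rw [hA.unique (hA₁.add_simpleFunc hA₂), add_mul, add_mul]
    exact (hs hA₁).add_simpleFunc (hs' hA₂)

theorem of_tendsto {s : ℕ → ℝ → ℂ} {B : ℕ → H →L[ℂ] H} {c : ℝ}
    (hm : ∀ n, StronglyMeasurable (s n)) (hc : ∀ n t, ‖s n t‖ ≤ c)
    (hs : ∀ t, Tendsto (fun n => s n t) atTop (𝓝 (f t)))
    (hB : ∀ n, E.HasIntegral (s n) (B n)) (hA : ∀ x, Tendsto (fun n => B n x) atTop (𝓝 (A x))) :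
    E.HasIntegral f A := fun x => by
  refine tendsto_nhds_unique (tendsto_const_nhds.inner (hA x)) ?_
  simp only [hB _ x]
  exact tendsto_integral_of_dominated_convergence (fun _ => c)
    (fun n => (hm n).aestronglyMeasurable) (integrable_const c)
    (fun n => .of_forall (hc n)) (.of_forall hs)

theorem cauchySeq_apply {s : ℕ → SimpleFunc ℝ ℂ} {B : ℕ → H →L[ℂ] H} {c : ℝ}
    (hc : ∀ n t, ‖s n t‖ ≤ c) (hs : ∀ t, Tendsto (fun n => s n t) atTop (𝓝 (f t)))
    (hB : ∀ n, E.HasIntegral (s n) (B n)) (x : H) : CauchySeq fun n => B n x := by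
  rw [cauchySeq_iff_tendsto_dist_atTop_0]
  have hdist (p : ℕ × ℕ) : dist (B p.1 x) (B p.2 x) ^ 2 =
      ∫ t, ‖s p.1 t - s p.2 t‖ ^ 2 ∂E.scalar x := by
    have hsub : E.HasIntegral (s p.1 - s p.2 : SimpleFunc ℝ ℂ) (B p.1 - B p.2) :=
      (hB p.1).sub (hB p.2) (fun _ => SimpleFunc.integrable_of_isFiniteMeasure _)
        fun _ => SimpleFunc.integrable_of_isFiniteMeasure _
    rw [dist_eq_norm]
    exact norm_apply_sq (mul_simpleFunc (s := star (s p.1 - s p.2)) hsub.star hsub) x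
  have hlim : Tendsto (fun p : ℕ × ℕ => ∫ t, ‖s p.1 t - s p.2 t‖ ^ 2 ∂E.scalar x) atTop
      (𝓝 (∫ _, 0 ∂E.scalar x)) := by
    refine tendsto_integral_filter_of_dominated_convergence (fun _ => (c + c) ^ 2)
      (.of_forall fun p => ?_) (.of_forall fun p => .of_forall fun t => ?_) (integrable_const _)
      (.of_forall fun t => ?_)
    · exact ((s p.1 - s p.2).stronglyMeasurable.norm.pow 2).aestronglyMeasurable
    · rw [norm_pow, norm_norm]
      gcongr
      exact norm_sub_le_of_le (hc _ _) (hc _ _)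
    · rw [← prod_atTop_atTop_eq]
      have h := (((hs t).comp tendsto_fst).sub ((hs t).comp tendsto_snd)).norm.pow 2
      simpa only [sub_self, norm_zero, ne_eq, OfNat.ofNat_ne_zero, not_false_eq_true,
        zero_pow] using! h
  rw [integral_zero] at hlim
  simpa only [← hdist, Real.sqrt_sq dist_nonneg, Real.sqrt_zero] using! hlim.sqrt

theorem exists_approx (E : SpectralMeasure H) (hf : StronglyMeasurable f) {c : ℝ}
    (hc : ∀ t, ‖f t‖ ≤ c) :
    ∃ (s : ℕ → SimpleFunc ℝ ℂ) (B : ℕ → H →L[ℂ] H) (A : H →L[ℂ] H),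
      (∀ n t, ‖s n t‖ ≤ c) ∧ (∀ t, Tendsto (fun n => s n t) atTop (𝓝 (f t))) ∧
      (∀ n, E.HasIntegral (s n) (B n)) ∧ (∀ x, Tendsto (fun n => B n x) atTop (𝓝 (A x))) ∧
      E.HasIntegral f A := by
  have hs (n : ℕ) (t : ℝ) : ‖hf.approxBounded c n t‖ ≤ c :=
    hf.norm_approxBounded_le ((norm_nonneg _).trans (hc 0)) n t
  have hlim (t : ℝ) : Tendsto (fun n => hf.approxBounded c n t) atTop (𝓝 (f t)) :=
    hf.tendsto_approxBounded_of_norm_le (hc t)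
  choose B hB using fun n => exists_simpleFunc E (hf.approxBounded c n)
  choose A hA using fun x => cauchySeq_tendsto_of_complete (cauchySeq_apply hs hlim hB x)
  have hA' (x : H) : Tendsto (fun n => B n x) atTop
      (𝓝 (continuousLinearMapOfTendsto B (tendsto_pi_nhds.2 hA) x)) := hA x
  exact ⟨_, B, _, hs, hlim, hB, hA',
    of_tendsto (fun n => (hf.approxBounded c n).stronglyMeasurable) hs hlim hB hA'⟩

theorem star_mul (hA : E.HasIntegral f A) (hB : E.HasIntegral g B) (hf : StronglyMeasurable f)
    (hg : StronglyMeasurable g) {c d : ℝ} (hc : ∀ t, ‖f t‖ ≤ c) (hd : ∀ t, ‖g t‖ ≤ d) :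
    E.HasIntegral (star f * g) (star A * B) := fun x => by
  obtain ⟨s, A', A₀, hs, hslim, hsA, hAlim, hA₀⟩ := exists_approx E hf hc
  obtain ⟨r, B', B₀, hr, hrlim, hrB, hBlim, hB₀⟩ := exists_approx E hg hd
  rw [hA.unique hA₀, hB.unique hB₀, mul_apply_eq_comp, ContinuousLinearMap.star_eq_adjoint,
    ContinuousLinearMap.adjoint_inner_right]
  have hint (n : ℕ) : ⟪A' n x, B' n x⟫_ℂ = ∫ t, star (s n t) * r n t ∂E.scalar x := by
    rw [← ContinuousLinearMap.adjoint_inner_right, ← ContinuousLinearMap.star_eq_adjoint]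
    exact mul_simpleFunc (s := star (s n)) (hsA n).star (hrB n) x
  refine tendsto_nhds_unique ((hAlim x).inner (hBlim x)) ?_
  simp only [hint]
  refine tendsto_integral_of_dominated_convergence (fun _ => c * d) (fun n => ?_)
    (integrable_const _) (fun n => .of_forall fun t => ?_)
    (.of_forall fun t => (hslim t).star.mul (hrlim t))
  · exact (star (s n) * r n).stronglyMeasurable.aestronglyMeasurable
  · rw [norm_mul, norm_star]
    exact mul_le_mul (hs n t) (hr n t) (norm_nonneg _) ((norm_nonneg _).trans (hs n t))

end HasIntegral

end HasIntegral

theorem hasIntegral_const (E : SpectralMeasure H) (c : ℂ) :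
    E.HasIntegral (fun _ => c) (algebraMap ℂ (H →L[ℂ] H) c) := fun x => by
  rw [Algebra.algebraMap_eq_smul_one, smul_apply, inner_smul_right, one_apply_eq_self,
    inner_self_eq_norm_sq_to_K, integral_const, E.real_scalar_univ x, mul_comm, Complex.real_smul,
    Complex.ofReal_pow]
  rfl

theorem HasIntegral.star_mul_coe {f g : ℝ →ᵇ ℂ} {A B : H →L[ℂ] H} (hA : E.HasIntegral f A)
    (hB : E.HasIntegral g B) : E.HasIntegral (star f * g : ℝ →ᵇ ℂ) (star A * B) :=
  hA.star_mul hB f.continuous.stronglyMeasurable g.continuous.stronglyMeasurable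
    f.norm_coe_le_norm g.norm_coe_le_norm

theorem exists_hasIntegral (E : SpectralMeasure H) (f : ℝ →ᵇ ℂ) : ∃ A, E.HasIntegral f A :=
  let ⟨_, _, A, _, _, _, _, hA⟩ :=
    HasIntegral.exists_approx E f.continuous.stronglyMeasurable f.norm_coe_le_norm
  ⟨A, hA⟩

/-- The functional calculus `f ↦ ∫ f dE` for bounded continuous functions. -/
def integral (E : SpectralMeasure H) : (ℝ →ᵇ ℂ) →⋆ₐ[ℂ] (H →L[ℂ] H) where
  toFun f := (E.exists_hasIntegral f).choose
  map_one' := (E.exists_hasIntegral 1).choose_spec.unique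
    (map_one (algebraMap ℂ (H →L[ℂ] H)) ▸ E.hasIntegral_const 1)
  map_mul' f g := by
    refine (E.exists_hasIntegral (f * g)).choose_spec.unique ?_
    have h := HasIntegral.star_mul_coe (f := star f)
      (E.exists_hasIntegral f).choose_spec.star (E.exists_hasIntegral g).choose_spec
    rwa [star_star, star_star] at h
  map_zero' := (E.exists_hasIntegral 0).choose_spec.unique
    (map_zero (algebraMap ℂ (H →L[ℂ] H)) ▸ E.hasIntegral_const 0)
  map_add' f g := (E.exists_hasIntegral (f + g)).choose_spec.unique <|
    (E.exists_hasIntegral f).choose_spec.add (E.exists_hasIntegral g).choose_spec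
      (fun _ => f.integrable _) fun _ => g.integrable _
  commutes' c := (E.exists_hasIntegral (algebraMap ℂ _ c)).choose_spec.unique
    (E.hasIntegral_const c)
  map_star' f := (E.exists_hasIntegral (star f)).choose_spec.unique
    (E.exists_hasIntegral f).choose_spec.star

theorem hasIntegral_integral (E : SpectralMeasure H) (f : ℝ →ᵇ ℂ) :
    E.HasIntegral f (E.integral f) :=
  (E.exists_hasIntegral f).choose_spec

theorem inner_integral_apply_integral_apply (E : SpectralMeasure H) (f g : ℝ →ᵇ ℂ) (x : H) :
    ⟪E.integral f x, E.integral g x⟫_ℂ = ∫ t, star (f t) * g t ∂E.scalar x := by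
  rw [← ContinuousLinearMap.adjoint_inner_right, ← ContinuousLinearMap.star_eq_adjoint,
    ← mul_apply_eq_comp]
  exact (E.hasIntegral_integral f).star_mul_coe (E.hasIntegral_integral g) x

theorem norm_integral_apply_lt {f g : ℝ →ᵇ ℂ} (h : ∀ t, ‖f t‖ < ‖g t‖) {x : H} (hx : x ≠ 0) :
    ‖E.integral f x‖ < ‖E.integral g x‖ := by
  have hnorm (f : ℝ →ᵇ ℂ) : ‖E.integral f x‖ ^ 2 = ∫ t, ‖f t‖ ^ 2 ∂E.scalar x :=
    ((E.hasIntegral_integral f).star_mul_coe (E.hasIntegral_integral f)).norm_apply_sq x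
  have hint (f : ℝ →ᵇ ℂ) : Integrable (fun t => ‖f t‖ ^ 2) (E.scalar x) :=
    (memLp_of_bounded (p := 2) (.of_forall fun t => ⟨norm_nonneg (f t), f.norm_coe_le_norm t⟩)
      f.continuous.norm.aestronglyMeasurable).integrable_sq
  have hpos (t : ℝ) : 0 < ‖g t‖ ^ 2 - ‖f t‖ ^ 2 :=
    sub_pos.2 (pow_lt_pow_left₀ (h t) (norm_nonneg _) two_ne_zero)
  refine lt_of_pow_lt_pow_left₀ 2 (norm_nonneg _) (sub_pos.1 ?_)
  rw [hnorm, hnorm, ← integral_sub (hint g) (hint f),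
    integral_pos_iff_support_of_nonneg (fun t => (hpos t).le) ((hint g).sub (hint f)),
    Set.eq_univ_of_forall (s := Function.support _) fun t => (hpos t).ne']
  refine (ENNReal.toReal_pos_iff.1 ?_).1
  rw [← Measure.real, E.real_scalar_univ]
  positivity

theorem integral_apply_injective {g : ℝ →ᵇ ℂ} (hg : ∀ t, g t ≠ 0) :
    Function.Injective (E.integral g) := by
  refine (injective_iff_map_eq_zero _).2 fun x hx => by_contra fun hx0 => ?_
  have h := norm_integral_apply_lt (E := E) (f := 0) (g := g)
    (fun t => by simpa using hg t) hx0
  simp [hx] at h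

theorem measurable_nnnorm_sq (g : ℝ →ᵇ ℂ) : Measurable fun t => ‖g t‖₊ ^ 2 :=
  (g.continuous.nnnorm.pow 2).measurable

theorem scalar_integral_apply (E : SpectralMeasure H) (g : ℝ →ᵇ ℂ) (x : H) :
    E.scalar (E.integral g x) =
      (E.scalar x).withDensity fun t => (‖g t‖₊ ^ 2 : ℝ≥0) := by
  have hfin : IsFiniteMeasure ((E.scalar x).withDensity fun t => (‖g t‖₊ ^ 2 : ℝ≥0)) := by
    refine isFiniteMeasure_withDensity
      (IsFiniteMeasure.lintegral_lt_top_of_bounded_to_ennreal _ ⟨‖g‖₊ ^ 2, fun t => ?_⟩).ne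
    gcongr
    exact g.nnnorm_coe_le_nnnorm t
  refine ext_of_forall_integral_eq_of_IsFiniteMeasure fun f => ?_
  let f' : ℝ →ᵇ ℂ := .ofNormedAddCommGroup (fun t => f t) (by fun_prop) ‖f‖
    fun t => by simpa using f.norm_coe_le_norm t
  have h := E.inner_integral_apply_integral_apply g (f' * g) x
  rw [map_mul, mul_apply_eq_comp, E.hasIntegral_integral f'] at h
  rw [integral_withDensity_eq_integral_smul (measurable_nnnorm_sq g)]
  refine Complex.ofReal_injective ?_
  rw [← integral_complex_ofReal, ← integral_complex_ofReal]
  refine h.trans (integral_congr_ae (.of_forall fun t => ?_))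
  simp only [BoundedContinuousFunction.mul_apply, NNReal.smul_def, NNReal.coe_pow, coe_nnnorm,
    smul_eq_mul, Complex.ofReal_mul, Complex.ofReal_pow, ← Complex.conj_mul']
  exact mul_left_comm _ _ _ |>.trans (mul_comm _ _)

section Graph

variable {A : H →ₗ.[ℂ] H} {g k : ℝ →ᵇ ℂ}

theorem IsIntegral.integral_apply_mem_domain (hA : E.IsIntegral φ A)
    (hk : ∀ t, k t = φ t * g t) (x : H) : E.integral g x ∈ A.domain := by
  rw [hA.mem_domain_iff, scalar_integral_apply,
    lintegral_withDensity_eq_lintegral_mul_non_measurable _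
      (measurable_nnnorm_sq g).coe_nnreal_ennreal
      (.of_forall fun _ => ENNReal.coe_lt_top)]
  refine IsFiniteMeasure.lintegral_lt_top_of_bounded_to_ennreal _ ⟨‖k‖₊ ^ 2, fun t => ?_⟩
  calc (‖g t‖₊ ^ 2 : ℝ≥0) * ENNReal.ofReal (φ t ^ 2) = (‖k t‖₊ ^ 2 : ℝ≥0) := by
        rw [hk, ENNReal.ofReal, ← ENNReal.coe_mul, ENNReal.coe_inj]
        ext
        simp [mul_pow, mul_comm, Real.coe_toNNReal _ (sq_nonneg _)]
    _ ≤ (‖k‖₊ ^ 2 : ℝ≥0) := by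
        gcongr
        exact k.nnnorm_coe_le_nnnorm t

theorem IsIntegral.inner_integral_apply (hA : E.IsIntegral φ A)
    (hk : ∀ t, k t = φ t * g t) (x : H) :
    ⟪E.integral g x, A ⟨_, hA.integral_apply_mem_domain hk x⟩⟫_ℂ =
      ⟪E.integral g x, E.integral k x⟫_ℂ := by
  refine (hA.inner_eq ⟨_, hA.integral_apply_mem_domain hk x⟩).trans ?_
  rw [inner_integral_apply_integral_apply, scalar_integral_apply,
    integral_withDensity_eq_integral_smul (measurable_nnnorm_sq g),
    ← integral_complex_ofReal]
  refine integral_congr_ae (.of_forall fun t => ?_)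
  simp only [hk, NNReal.smul_def, NNReal.coe_pow, coe_nnnorm, smul_eq_mul, Complex.ofReal_mul,
    Complex.ofReal_pow, ← Complex.conj_mul', RCLike.star_def]
  ring

theorem IsIntegral.mem_graph (hA : E.IsIntegral φ A) (hg : ∀ t, g t ≠ 0)
    (hk : ∀ t, k t = φ t * g t) (x : H) : (E.integral g x, E.integral k x) ∈ A.graph := by
  let D : H →ₗ[ℂ] H := E.integral (star g) ∘ₗ
    (A.toFun ∘ₗ (E.integral g : H →ₗ[ℂ] H).codRestrict _ (hA.integral_apply_mem_domain hk) -
      (E.integral k : H →ₗ[ℂ] H))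
  have hD : D = 0 := by
    refine (inner_map_self_eq_zero D).1 fun y => ?_
    rw [← inner_conj_symm, map_eq_zero]
    change ⟪y, E.integral (star g)
      (A ⟨_, hA.integral_apply_mem_domain hk y⟩ - E.integral k y)⟫_ℂ = 0
    rw [map_star, ContinuousLinearMap.star_eq_adjoint, ContinuousLinearMap.adjoint_inner_right,
      inner_sub_right, hA.inner_integral_apply hk, sub_self]
  have hinj := integral_apply_injective (E := E) (g := star g) fun t => star_ne_zero.2 (hg t)
  have h := (map_eq_zero_iff _ hinj).1 (congrArg (fun D : H →ₗ[ℂ] H => D x) hD)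
  exact A.mem_graph_iff.2 ⟨⟨_, hA.integral_apply_mem_domain hk x⟩, rfl, sub_eq_zero.1 h⟩

end Graph

section Uniqueness

variable {Q : H →ₗ.[ℂ] H}

theorem ofReal_sub_I_ne_zero (t : ℝ) : (t : ℂ) - Complex.I ≠ 0 := fun h => by
  simpa using congrArg Complex.im h

/-- The function `t ↦ (t - i)⁻¹`, whose integral is the resolvent of `∫ t dE` at `i`. -/
def resolventFun : ℝ →ᵇ ℂ :=
  .ofNormedAddCommGroup (fun t => ((t : ℂ) - Complex.I)⁻¹)
    (Continuous.inv₀ (by fun_prop) ofReal_sub_I_ne_zero) 1 fun t => by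
      rw [norm_inv]
      exact inv_le_one_of_one_le₀ (by simpa using Complex.abs_im_le_norm ((t : ℂ) - Complex.I))

theorem resolventFun_apply (t : ℝ) : resolventFun t = ((t : ℂ) - Complex.I)⁻¹ := rfl

theorem IsIntegral.mem_graph_resolvent (hQ : E.IsIntegral (fun t => t) Q) (x : H) :
    (E.integral resolventFun x, x + Complex.I • E.integral resolventFun x) ∈ Q.graph := by
  have hk (t : ℝ) : (1 + Complex.I • resolventFun : ℝ →ᵇ ℂ) t = t * resolventFun t := by
    have := ofReal_sub_I_ne_zero t
    simp only [BoundedContinuousFunction.add_apply, BoundedContinuousFunction.smul_apply,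
      BoundedContinuousFunction.coe_one, Pi.one_apply, resolventFun_apply, smul_eq_mul]
    field_simp
    ring
  have h := hQ.mem_graph (fun t => inv_ne_zero (ofReal_sub_I_ne_zero t)) hk x
  rwa [map_add, map_one, map_smul] at h

theorem IsIntegral.inner_eq_of_mem_graph (hQ : E.IsIntegral φ Q) {x y : H}
    (h : (x, y) ∈ Q.graph) : ⟪x, y⟫_ℂ = ((∫ t, φ t ∂E.scalar x : ℝ) : ℂ) := by
  obtain ⟨z, rfl, rfl⟩ := Q.mem_graph_iff.1 h
  exact hQ.inner_eq z

theorem integral_resolventFun_eq (hE : E.IsIntegral (fun t => t) Q)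
    (hF : F.IsIntegral (fun t => t) Q) : E.integral resolventFun = F.integral resolventFun := by
  ext x
  have h := Q.graph.sub_mem (hE.mem_graph_resolvent x) (hF.mem_graph_resolvent x)
  rw [Prod.mk_sub_mk, add_sub_add_left_eq_sub, ← smul_sub] at h
  have him := congrArg Complex.im (hE.inner_eq_of_mem_graph h)
  rw [inner_smul_right, inner_self_eq_norm_sq_to_K, Complex.I_mul_im, Complex.ofReal_im] at him
  simpa [← Complex.ofReal_pow, sub_eq_zero] using him

theorem IsIntegral.scalar_eq (hE : E.IsIntegral (fun t => t) Q)
    (hF : F.IsIntegral (fun t => t) Q) (x : H) : E.scalar x = F.scalar x := by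
  refine ext_of_forall_mem_subalgebra_integral_eq_of_polish (𝕜 := ℂ)
    (A := StarAlgHom.equalizer E.integral F.integral) (fun s t hst => ?_) fun g hg => ?_
  · refine ⟨_, ⟨_, ⟨resolventFun, integral_resolventFun_eq hE hF, rfl⟩, rfl⟩, fun h => hst ?_⟩
    have hinv : ((s : ℂ) - Complex.I)⁻¹ = ((t : ℂ) - Complex.I)⁻¹ := h
    simpa only [inv_inj, sub_left_inj, Complex.ofReal_inj] using hinv
  · rw [← E.hasIntegral_integral g x, ← F.hasIntegral_integral g x]
    exact congrArg (fun B : H →L[ℂ] H => ⟪x, B x⟫_ℂ) hg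

end Uniqueness

/-- The image of a spectral measure under conjugation by a fundamental symmetry. -/
def conj (E : SpectralMeasure H) (hJ : IsFundamentalSymmetry J) : SpectralMeasure H where
  proj S := J * E.proj S * J
  isSelfAdjoint S hS := by
    simpa only [hJ.isSelfAdjoint.star_eq] using (E.isSelfAdjoint S hS).conjugate J
  proj_univ := by rw [E.proj_univ, mul_one, hJ.sq_eq_one]
  proj_inter S S' hS hS' := by
    calc J * E.proj (S ∩ S') * J = J * E.proj S * 1 * E.proj S' * J := by
          rw [E.proj_inter S S' hS hS', mul_one]; simp only [mul_assoc]
      _ = J * E.proj S * J * (J * E.proj S' * J) := by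
          rw [← hJ.sq_eq_one]; simp only [mul_assoc]
  hasSum S hS hd x := (E.hasSum S hS hd (J x)).mapL J

/-- The image of a spectral measure under `t ↦ -t`. -/
def reflect (E : SpectralMeasure H) : SpectralMeasure H where
  proj S := E.proj (Neg.neg ⁻¹' S)
  isSelfAdjoint S hS := E.isSelfAdjoint _ (measurable_neg hS)
  proj_univ := by rw [Set.preimage_univ, E.proj_univ]
  proj_inter S S' hS hS' := by
    rw [Set.preimage_inter, E.proj_inter _ _ (measurable_neg hS) (measurable_neg hS')]
  hasSum S hS hd x := by
    rw [Set.preimage_iUnion]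
    exact E.hasSum _ (fun i => measurable_neg (hS i)) (fun i j h => (hd h).preimage _) x

theorem scalar_conj (E : SpectralMeasure H) (hJ : IsFundamentalSymmetry J) (x : H) :
    (E.conj hJ).scalar x = E.scalar (J x) := by
  ext S hS
  rw [scalar_apply _ _ hS, scalar_apply _ _ hS, hJ.inner_left]
  rfl

theorem scalar_reflect (E : SpectralMeasure H) (x : H) :
    E.reflect.scalar x = (E.scalar x).map Neg.neg := by
  ext S hS
  rw [scalar_apply _ _ hS, Measure.map_apply measurable_neg hS,
    scalar_apply _ _ (measurable_neg hS)]
  rfl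

theorem IsIntegral.conj {A A' : H →ₗ.[ℂ] H} (hA : E.IsIntegral φ A)
    (hJ : IsFundamentalSymmetry J) (h : ∀ x y, (x, y) ∈ A'.graph ↔ (J x, J y) ∈ A.graph) :
    (E.conj hJ).IsIntegral φ A' where
  mem_domain_iff x := by
    rw [scalar_conj, ← hA.mem_domain_iff, LinearPMap.mem_domain_iff, LinearPMap.mem_domain_iff]
    simp only [h]
    exact ⟨fun ⟨y, hy⟩ => ⟨J y, hy⟩, fun ⟨y, hy⟩ => ⟨J y, by rwa [hJ.apply_apply]⟩⟩
  inner_eq x := by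
    rw [scalar_conj, ← hA.inner_eq_of_mem_graph ((h _ _).1 (A'.mem_graph x)), hJ.inner_left,
      hJ.apply_apply]

theorem IsIntegral.reflect_of_neg {Q : H →ₗ.[ℂ] H} (hQ : E.IsIntegral (fun t => t) (-Q)) :
    E.reflect.IsIntegral (fun t => t) Q where
  mem_domain_iff x := by
    rw [scalar_reflect, lintegral_map (by fun_prop) measurable_neg]
    simpa only [even_two.neg_pow] using! hQ.mem_domain_iff x
  inner_eq x := by
    have h := hQ.inner_eq x
    rw [LinearPMap.neg_apply, inner_neg_right] at h
    rw [scalar_reflect, integral_map measurable_neg.aemeasurable (by fun_prop),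
      MeasureTheory.integral_neg, Complex.ofReal_neg, ← h, neg_neg]

section Anticommuting

variable {Q : H →ₗ.[ℂ] H}

theorem scalar_apply_map_neg (hE : E.IsIntegral (fun t => t) Q) (hQ : Anticommutes J Q)
    (hJ : IsFundamentalSymmetry J) (x : H) :
    (E.scalar (J x)).map Neg.neg = E.scalar x := by
  rw [← scalar_conj E hJ, ← scalar_reflect]
  exact (hE.conj hJ (hQ.mem_graph_neg_iff hJ)).reflect_of_neg.scalar_eq hE x

theorem integral_eq_of_comp_neg (hE : E.IsIntegral (fun t => t) Q) (hQ : Anticommutes J Q)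
    (hJ : IsFundamentalSymmetry J) {f g : ℝ →ᵇ ℂ} (hfg : ∀ t, g t = f (-t)) :
    E.integral g = J * E.integral f * J := by
  refine (E.hasIntegral_integral g).unique fun x => ?_
  calc ⟪x, J (E.integral f (J x))⟫_ℂ = ∫ t, f t ∂E.scalar (J x) := by
        rw [← hJ.inner_left, E.hasIntegral_integral]
    _ = ∫ t, g t ∂(E.scalar (J x)).map Neg.neg := by
        rw [integral_map measurable_neg.aemeasurable g.continuous.aestronglyMeasurable]
        simp only [hfg, neg_neg]
    _ = ∫ t, g t ∂E.scalar x := by rw [scalar_apply_map_neg hE hQ hJ]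

end Anticommuting

section Exp

variable {A : H →ₗ.[ℂ] H}

theorem abs_one_sub_exp_div_lt (t : ℝ) : |(1 - Real.exp t) / (1 + Real.exp t)| < 1 := by
  have ht := Real.exp_pos t
  have ht' : 0 < 1 + Real.exp t := by positivity
  rw [abs_div, abs_of_pos ht', div_lt_one ht', abs_lt]
  constructor <;> linarith

/-- The function `t ↦ (1 - e^t) / (1 + e^t)`, whose integral `(1 - A) (1 + A)⁻¹` is the Cayley
transform of `A = ∫ e^t dE`. -/
def cayleyExp : ℝ →ᵇ ℂ :=
  .ofNormedAddCommGroup (fun t => ((1 - Real.exp t) / (1 + Real.exp t) : ℝ))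
    (Complex.continuous_ofReal.comp
      (Continuous.div (by fun_prop) (by fun_prop) fun t => by positivity))
    1 fun t => (Complex.norm_real _).trans_le (abs_one_sub_exp_div_lt t).le

theorem cayleyExp_apply (t : ℝ) :
    cayleyExp t = ((1 - Real.exp t) / (1 + Real.exp t) : ℝ) := rfl

theorem norm_cayleyExp_lt (t : ℝ) : ‖cayleyExp t‖ < 1 :=
  (Complex.norm_real _).trans_lt (abs_one_sub_exp_div_lt t)

theorem star_cayleyExp : star cayleyExp = cayleyExp := by
  ext t
  rw [BoundedContinuousFunction.star_apply, cayleyExp_apply, RCLike.star_def, Complex.conj_ofReal]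

theorem cayleyExp_neg (t : ℝ) : cayleyExp (-t) = -cayleyExp t := by
  rw [cayleyExp_apply, cayleyExp_apply, ← Complex.ofReal_neg, Complex.ofReal_inj, Real.exp_neg]
  have := Real.exp_pos t
  field_simp
  ring

theorem one_sub_cayleyExp (t : ℝ) : 1 - cayleyExp t = Real.exp t * (1 + cayleyExp t) := by
  rw [cayleyExp_apply]
  norm_cast
  have := Real.exp_pos t
  field_simp
  ring

theorem one_add_cayleyExp_ne_zero (t : ℝ) : 1 + cayleyExp t ≠ 0 := fun h => by
  have hlt := norm_cayleyExp_lt t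
  rw [← neg_eq_of_add_eq_zero_right h, norm_neg, norm_one] at hlt
  exact hlt.false

theorem isSelfAdjoint_integral_cayleyExp (E : SpectralMeasure H) :
    IsSelfAdjoint (E.integral cayleyExp) := by
  rw [isSelfAdjoint_iff, ← map_star, star_cayleyExp]

theorem norm_integral_cayleyExp_apply_lt (E : SpectralMeasure H) {x : H} (hx : x ≠ 0) :
    ‖E.integral cayleyExp x‖ < ‖x‖ := by
  simpa only [map_one] using!
    norm_integral_apply_lt (E := E) (f := cayleyExp) (g := 1)
      (by simpa using norm_cayleyExp_lt) hx

theorem anticommute_integral_cayleyExp {Q : H →ₗ.[ℂ] H} (hE : E.IsIntegral (fun t => t) Q)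
    (hQ : Anticommutes J Q) (hJ : IsFundamentalSymmetry J) :
    J * E.integral cayleyExp = -(E.integral cayleyExp * J) := by
  have h := integral_eq_of_comp_neg hE hQ hJ (f := cayleyExp) (g := -cayleyExp) fun t =>
    (cayleyExp_neg t).symm
  rw [← neg_mul, ← map_neg, h, mul_assoc, hJ.sq_eq_one, mul_one]

theorem IsIntegral.add_sub_mem_graph (hA : E.IsIntegral Real.exp A) (x : H) :
    (x + E.integral cayleyExp x, x - E.integral cayleyExp x) ∈ A.graph := by
  have h := hA.mem_graph (g := 1 + cayleyExp) (k := 1 - cayleyExp) one_add_cayleyExp_ne_zero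
    one_sub_cayleyExp x
  rwa [map_add, map_sub, map_one] at h

theorem IsIntegral.eq_zero_of_neg_mem_graph (hA : E.IsIntegral Real.exp A) {x : H}
    (hx : (x, -x) ∈ A.graph) : x = 0 := by
  have h := congrArg Complex.re (hA.inner_eq_of_mem_graph hx)
  have hnonneg : 0 ≤ ∫ t, Real.exp t ∂E.scalar x :=
    integral_nonneg fun t => (Real.exp_pos t).le
  rw [inner_neg_right, Complex.neg_re, Complex.ofReal_re] at h
  have hnorm : (⟪x, x⟫_ℂ).re = ‖x‖ ^ 2 := inner_self_eq_norm_sq (𝕜 := ℂ) x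
  exact norm_eq_zero.1 (pow_eq_zero_iff two_ne_zero |>.1 (by linarith [sq_nonneg ‖x‖]))

theorem IsIntegral.mem_graph_exp_iff (hA : E.IsIntegral Real.exp A) {x y : H} :
    (x, y) ∈ A.graph ↔ E.integral cayleyExp (x + y) = x - y := by
  set T := E.integral cayleyExp
  have hmem : (x + y + T (x + y), x + y - T (x + y)) ∈ A.graph := hA.add_sub_mem_graph (x + y)
  refine ⟨fun hxy => ?_, fun hT => ?_⟩
  · have hdiff := A.graph.sub_mem hmem (A.graph.smul_mem (2 : ℂ) hxy)
    rw [Prod.smul_mk, Prod.mk_sub_mk, show x + y - T (x + y) - (2 : ℂ) • y =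
      -(x + y + T (x + y) - (2 : ℂ) • x) by module] at hdiff
    rw [← sub_eq_zero, ← hA.eq_zero_of_neg_mem_graph hdiff]
    module
  · rw [hT] at hmem
    convert A.graph.smul_mem (2⁻¹ : ℂ) hmem using 1
    rw [Prod.smul_mk]
    congr 1 <;> module

end Exp

end SpectralMeasure

end Spectral

theorem mem_graph_compPMap_iff (hJ : IsFundamentalSymmetry J) {A : H →ₗ.[ℂ] H} {x y : H} :
    (x, y) ∈ ((J : H →ₗ[ℂ] H).compPMap A).graph ↔ (x, J y) ∈ A.graph := by
  simp only [LinearPMap.mem_graph_iff]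
  refine exists_congr fun z => and_congr_right fun _ => ⟨fun h => ?_, fun h => ?_⟩
  · rw [← h]
    exact (hJ.apply_apply _).symm
  · exact (congrArg J h).trans (hJ.apply_apply _)

theorem IsFundamentalSymmetry.compPMap_compPMap (hJ : IsFundamentalSymmetry J) (A : H →ₗ.[ℂ] H) :
    (J : H →ₗ[ℂ] H).compPMap ((J : H →ₗ[ℂ] H).compPMap A) = A := by
  refine LinearPMap.eq_of_eq_graph (Submodule.ext fun ⟨x, y⟩ => ?_)
  rw [mem_graph_compPMap_iff hJ, mem_graph_compPMap_iff hJ, hJ.apply_apply]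

theorem mem_graph_directSumOperator_image (hJ : IsFundamentalSymmetry J)
    (h : IsDirectSumPair J Lp Lm) {x y : H} :
    (x, y) ∈ (directSumOperator (image J Lp) (image J Lm)).graph ↔
      (J x, J y) ∈ (directSumOperator Lp Lm).graph := by
  rw [mem_graph_directSumOperator (h.disjoint_image hJ), mem_graph_directSumOperator h.disjoint,
    hJ.mem_image_iff, hJ.mem_image_iff, map_add, map_sub]

theorem SpectralMeasure.exists_compPMap_eq_directSumOperator {E : SpectralMeasure H}
    {Q A : H →ₗ.[ℂ] H} (hQ : E.IsIntegral (fun t => t) Q) (hA : E.IsIntegral Real.exp A)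
    (hanti : Anticommutes J Q) (hJ : IsFundamentalSymmetry J) :
    ∃ Lp Lm, IsDirectSumPair J Lp Lm ∧
      (J : H →ₗ[ℂ] H).compPMap A = directSumOperator Lp Lm := by
  have hT : IsTransitionOperator J (E.integral cayleyExp) _ _ :=
    ⟨E.isSelfAdjoint_integral_cayleyExp, fun _ => E.norm_integral_cayleyExp_apply_lt,
      anticommute_integral_cayleyExp hQ hanti hJ, rfl, rfl⟩
  refine ⟨_, _, hT.isDirectSumPair hJ, LinearPMap.eq_of_eq_graph (Submodule.ext fun ⟨x, y⟩ => ?_)⟩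
  rw [mem_graph_compPMap_iff hJ, hA.mem_graph_exp_iff, hT.mem_graph_directSumOperator hJ]

theorem IsExpForm.exists_isDirectSumPair {Q C : H →ₗ.[ℂ] H} (h : IsExpForm J Q C)
    (hJ : IsFundamentalSymmetry J) :
    ∃ Lp Lm, IsDirectSumPair J Lp Lm ∧ C = directSumOperator Lp Lm := by
  obtain ⟨A, ⟨E, hQ, hA⟩, rfl⟩ := h.eq_comp
  exact SpectralMeasure.exists_compPMap_eq_directSumOperator hQ hA h.anticommutes hJ

theorem IsExpForm.adjoint {Q C : H →ₗ.[ℂ] H} (h : IsExpForm J Q C)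
    (hJ : IsFundamentalSymmetry J) : IsExpForm J (-Q) C† := by
  obtain ⟨Lp, Lm, hL, hC⟩ := h.exists_isDirectSumPair hJ
  obtain ⟨A, ⟨E, hQ, hA⟩, hCA⟩ := h.eq_comp
  refine ⟨isSelfAdjoint_neg h.isSelfAdjoint, h.anticommutes.neg, (J : H →ₗ[ℂ] H).compPMap C†,
    ⟨E.conj hJ, hQ.conj hJ (h.anticommutes.mem_graph_neg_iff hJ), hA.conj hJ fun x y => ?_⟩,
    (hJ.compPMap_compPMap _).symm⟩
  rw [mem_graph_compPMap_iff hJ, hC, hL.adjoint_directSumOperator hJ,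
    mem_graph_directSumOperator_image hJ hL, ← hC, hCA, mem_graph_compPMap_iff hJ,
    hJ.apply_apply]

end Krein

end

theorem corollary1 {H : Type*} [NormedAddCommGroup H] [InnerProductSpace ℂ H] [CompleteSpace H]
    (J : H →L[ℂ] H) (hJ : Krein.IsFundamentalSymmetry J) :
    (∀ C : H →ₗ.[ℂ] H, Krein.IsCOperator J C →
      Dense (C.domain : Set H) ∧ Krein.IsCOperator J C†) ∧
    (∀ Lp Lm : Submodule ℂ H, Krein.IsDirectSumPair J Lp Lm →
      Krein.IsDirectSumPair J (Krein.image J Lp) (Krein.image J Lm) ∧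
      Krein.IsMaximalNegative J (Krein.image J Lm) ∧
      (Krein.directSumOperator Lp Lm)† =
        Krein.directSumOperator (Krein.image J Lp) (Krein.image J Lm) ∧
      (∃! T : H →L[ℂ] H, Krein.IsTransitionOperator J T Lp Lm) ∧
      ∀ T : H →L[ℂ] H, Krein.IsTransitionOperator J T Lp Lm ↔
        Krein.IsTransitionOperator J (-T) (Krein.image J Lp) (Krein.image J Lm)) ∧
    (∀ Q C : H →ₗ.[ℂ] H, Krein.IsExpForm J Q C →
      Krein.IsExpForm J (-Q) C† ∧
      ∃ Lp Lm : Submodule ℂ H, Krein.IsDirectSumPair J Lp Lm ∧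
        C = Krein.directSumOperator Lp Lm ∧
        C† = Krein.directSumOperator (Krein.image J Lp) (Krein.image J Lm)) := by
  refine ⟨?_, ?_, ?_⟩
  · rintro C ⟨Lp, Lm, h, rfl⟩
    obtain ⟨T, hT⟩ := h.exists_isTransitionOperator hJ
    exact ⟨h.dense_domain_directSumOperator hJ, _, _, (hT.neg_image hJ).isDirectSumPair hJ,
      h.adjoint_directSumOperator hJ⟩
  · intro Lp Lm h
    obtain ⟨T, hT⟩ := h.exists_isTransitionOperator hJ
    have hdual := hT.neg_image hJ
    exact ⟨hdual.isDirectSumPair hJ, hdual.isMaximalNegative hJ, h.adjoint_directSumOperator hJ,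
      ⟨T, hT, fun S hS => hT.unique hS hJ⟩,
      fun S => (Krein.IsTransitionOperator.neg_image_iff hJ).symm⟩
  · intro Q C h
    obtain ⟨Lp, Lm, hL, hC⟩ := h.exists_isDirectSumPair hJ
    exact ⟨h.adjoint hJ, Lp, Lm, hL, hC, by rw [hC, hL.adjoint_directSumOperator hJ]⟩
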